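/- Let $G$ be a finite group, $k$ a field and $r$ an integer. Let $\mathbf{stmod}(kG)$ be the stable module category of finitely generated $kG$-modules, with Heller functor $\Omega$ and shift $\Sigma=\Omega^{-1}$; write $\Omega^{n}=\Sigma^{-n}$ for $n\in\mathbb Z$. The support of a natural transformation $\alpha$ between endofunctors of $\mathbf{stmod}(kG)$ is the set of isomorphism classes of indecomposable objects $U$ with $\alpha_U\neq 0$. A morphism is almost vanishing if, up to an isomorphism of its target, it is the third morphism $Z\to\Sigma X$ of an Auslander–Reiten triangle $X\to Y\to Z\to\Sigma X$. If $M$ is a periodic indecomposable object, $\zeta:M\to\Omega(M)$ is an almost vanishing morphism and $\theta:\Omega(M)\to\Sigma^r(M)$ is an isomorphism, then the Linckelmann–Stancu transformation of degree $r$ attached to $(M,\zeta,\theta)$ means the natural transformation $\psi:\mathrm{Id}\to\Sigma^r$ (it is unique if it exists) with $\psi_M=\theta\circ\zeta$ and $\psi_V=0$ for every indecomposable object $V\not\cong M$. Let $\phi:\mathrm{Id}\to\Sigma^r$ be a natural transformation on $\mathbf{stmod}(kG)$ whose support consists of a single indecomposable object $M$. Then $\Sigma^r(M)\cong\Omega(M)$,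 and under such an identification $\phi_M:M\to\Omega(M)$ is an almost vanishing morphism. If moreover $r\neq -1$, then $M\cong\Omega^{r+1}(M)$, so that $M$ is periodic ($M\cong\Omega^n(M)$ for some $n>0$), and $\phi$ is a non-zero scalar multiple of a Linckelmann–Stancu transformation of degree $r$ attached to $(M,\zeta,\theta)$ for some $\zeta$ and $\theta$. If in addition $k$ is algebraically closed, then for every almost vanishing $\zeta:M\to\Omega(M)$ and every isomorphism $\theta:\Omega(M)\to\Sigma^r(M)$ the Linckelmann–Stancu transformation attached to $(M,\zeta,\theta)$ exists, and $\phi$ is a non-zero scalar multiple of it. -/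

import Mathlib

universe u

open CategoryTheory

namespace StMod

open CategoryTheory.Limits
open scoped TensorProduct ModuleCat

noncomputable section

section Modules

/-! ### The relatively free module `kG ⊗ₖ M` attached to a `kG`-module `M` -/

variable (k G : Type u) [Field k] [Group G]
variable (M N : Type u) [AddCommGroup M] [Module k M] [Module (MonoidAlgebra k G) M]
  [IsScalarTower k (MonoidAlgebra k G) M]
variable [AddCommGroup N] [Module k N] [Module (MonoidAlgebra k G) N]
  [IsScalarTower k (MonoidAlgebra k G) N]

/-- The action map `kG ⊗ₖ M → M`, `a ⊗ m ↦ a m`; it is `kG`-linear and surjective, and its source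
is a free `kG`-module (`kG` acts on the left tensor factor only). -/
def act : MonoidAlgebra k G ⊗[k] M →ₗ[MonoidAlgebra k G] M :=
  TensorProduct.AlgebraTensorModule.lift
    { toFun := fun a => Algebra.lsmul k k M a
      map_add' := fun a b => map_add _ a b
      map_smul' := fun a b => by
        ext m
        simp }

@[simp] theorem act_tmul (a : MonoidAlgebra k G) (m : M) : act k G M (a ⊗ₜ[k] m) = a • m := rfl

/-- The map `kG ⊗ₖ M → kG ⊗ₖ N` induced by a `kG`-linear map `M → N`. -/
def freeMap {M N : Type u} [AddCommGroup M] [Module k M] [Module (MonoidAlgebra k G) M]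
    [IsScalarTower k (MonoidAlgebra k G) M] [AddCommGroup N] [Module k N]
    [Module (MonoidAlgebra k G) N] [IsScalarTower k (MonoidAlgebra k G) N]
    (f : M →ₗ[MonoidAlgebra k G] N) :
    MonoidAlgebra k G ⊗[k] M →ₗ[MonoidAlgebra k G] MonoidAlgebra k G ⊗[k] N :=
  TensorProduct.AlgebraTensorModule.map LinearMap.id (f.restrictScalars k)

variable {M N}

@[simp] theorem freeMap_tmul (f : M →ₗ[MonoidAlgebra k G] N) (a : MonoidAlgebra k G) (m : M) :
    freeMap k G f (a ⊗ₜ[k] m) = a ⊗ₜ[k] f m := rfl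

theorem freeMap_id (x : MonoidAlgebra k G ⊗[k] M) :
    freeMap k G (LinearMap.id : M →ₗ[MonoidAlgebra k G] M) x = x := by
  induction x with
  | zero => simp
  | tmul a m => simp
  | add x y hx hy => simp [hx, hy]

theorem freeMap_comp {L : Type u} [AddCommGroup L] [Module k L] [Module (MonoidAlgebra k G) L]
    [IsScalarTower k (MonoidAlgebra k G) L] (f : M →ₗ[MonoidAlgebra k G] N)
    (g : N →ₗ[MonoidAlgebra k G] L) (x : MonoidAlgebra k G ⊗[k] M) :
    freeMap k G (g ∘ₗ f) x = freeMap k G g (freeMap k G f x) := by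
  induction x with
  | zero => simp
  | tmul a m => simp
  | add x y hx hy => simp [hx, hy]

theorem freeMap_add (f g : M →ₗ[MonoidAlgebra k G] N) (x : MonoidAlgebra k G ⊗[k] M) :
    freeMap k G (f + g) x = freeMap k G f x + freeMap k G g x := by
  induction x with
  | zero => simp
  | tmul a m => simp [TensorProduct.tmul_add]
  | add x y hx hy => rw [map_add, hx, hy, map_add, map_add]; abel

theorem act_freeMap (f : M →ₗ[MonoidAlgebra k G] N) (x : MonoidAlgebra k G ⊗[k] M) :
    act k G N (freeMap k G f x) = f (act k G M x) := by
  induction x with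
  | zero => simp
  | tmul a m => simp
  | add x y hx hy => simp [hx, hy]

/-- If `P` is a projective `kG`-module, then so is the kernel of `kG ⊗ₖ P → P`. -/
theorem projective_ker_act [Module.Projective (MonoidAlgebra k G) M] :
    Module.Projective (MonoidAlgebra k G) (LinearMap.ker (act k G M)) := by
  have hsurj : Function.Surjective (act k G M) := fun m => ⟨1 ⊗ₜ m, by simp⟩
  obtain ⟨s, hs⟩ := Module.projective_lifting_property (act k G M) LinearMap.id hsurj
  have hs' : ∀ m, act k G M (s m) = m := fun m => LinearMap.congr_fun hs m
  refine Module.Projective.of_split (LinearMap.ker (act k G M)).subtype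
    (LinearMap.codRestrict _ (LinearMap.id - s ∘ₗ act k G M) fun x => ?_) ?_
  · simp [hs']
  · ext x
    have hx : act k G M x = 0 := x.2
    simp [hx]

variable (M) [Fintype G]

/-- The coaction `M → kG ⊗ₖ M`, `m ↦ ∑ g, g ⊗ g⁻¹ m`; it is `kG`-linear and injective, and
its target is an injective (and free) `kG`-module. -/
def coact : M →ₗ[MonoidAlgebra k G] MonoidAlgebra k G ⊗[k] M where
  toFun m := ∑ g : G, (MonoidAlgebra.single g (1 : k)) ⊗ₜ[k]
    ((MonoidAlgebra.single g⁻¹ (1 : k) : MonoidAlgebra k G) • m)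
  map_add' m n := by
    simp [smul_add, TensorProduct.tmul_add, Finset.sum_add_distrib]
  map_smul' a m := by
    induction a using MonoidAlgebra.induction_linear with
    | zero => simp
    | add a b ha hb =>
      simp only [RingHom.id_apply] at ha hb ⊢
      simp only [add_smul, ← ha, ← hb, ← Finset.sum_add_distrib, smul_add,
        TensorProduct.tmul_add]
    | single h c =>
      simp only [RingHom.id_apply, Finset.smul_sum, TensorProduct.smul_tmul', smul_smul,
        MonoidAlgebra.single_mul_single, smul_eq_mul, mul_one, one_mul]
      refine (Fintype.sum_equiv (Equiv.mulLeft h) _ _ fun g => ?_).symm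
      have e1 : (MonoidAlgebra.single (h * g) c : MonoidAlgebra k G)
          = c • MonoidAlgebra.single (h * g) 1 := by simp
      have e2 : (MonoidAlgebra.single ((h * g)⁻¹ * h) c : MonoidAlgebra k G)
          = c • MonoidAlgebra.single g⁻¹ 1 := by simp
      simp only [Equiv.coe_mulLeft]
      rw [e1, e2, smul_assoc, TensorProduct.smul_tmul c]

theorem coact_apply (m : M) : coact k G M m = ∑ g : G, (MonoidAlgebra.single g (1 : k)) ⊗ₜ[k]
    ((MonoidAlgebra.single g⁻¹ (1 : k) : MonoidAlgebra k G) • m) := rfl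

variable {M}

theorem freeMap_coact (f : M →ₗ[MonoidAlgebra k G] N) (m : M) :
    freeMap k G f (coact k G M m) = coact k G N (f m) := by
  simp [coact_apply]

/-- If `P` is a projective `kG`-module, then the coaction `P → kG ⊗ₖ P` splits. -/
theorem exists_retraction_coact [Module.Projective (MonoidAlgebra k G) M] :
    ∃ r : MonoidAlgebra k G ⊗[k] M →ₗ[MonoidAlgebra k G] M, ∀ m, r (coact k G M m) = m := by
  classical
  have hsurj : Function.Surjective (act k G M) := fun m => ⟨1 ⊗ₜ m, by simp⟩
  obtain ⟨s, hs⟩ := Module.projective_lifting_property (act k G M) LinearMap.id hsurj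
  have hs' : ∀ m, act k G M (s m) = m := fun m => LinearMap.congr_fun hs m
  let c : MonoidAlgebra k G →ₗ[k] k :=
    { toFun := fun a => a.coeff 1
      map_add' := fun a b => rfl
      map_smul' := fun a b => rfl }
  let ε : MonoidAlgebra k G ⊗[k] M →ₗ[k] M :=
    TensorProduct.lift ((LinearMap.lsmul k M).comp c)
  have key : ∀ x : MonoidAlgebra k G ⊗[k] M,
      ∑ g : G, (MonoidAlgebra.single g (1 : k) : MonoidAlgebra k G) •
        ε ((MonoidAlgebra.single g⁻¹ (1 : k) : MonoidAlgebra k G) • x) = act k G M x := by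
    intro x
    induction x with
    | zero => simp
    | add x y hx hy => simp only [smul_add, map_add, Finset.sum_add_distrib, hx, hy]
    | tmul a m =>
      induction a using MonoidAlgebra.induction_linear with
      | zero => simp
      | add a b ha hb =>
        simp only [TensorProduct.add_tmul, smul_add, map_add, Finset.sum_add_distrib, ha, hb]
      | single h d =>
        rw [Finset.sum_eq_single h]
        · have e : (MonoidAlgebra.single h d : MonoidAlgebra k G)
              = d • MonoidAlgebra.single h 1 := by simp
          have hc : c (MonoidAlgebra.single 1 d) = d := by
            change (MonoidAlgebra.single (1 : G) d).coeff 1 = d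
            simp
          simp only [ε, TensorProduct.smul_tmul', smul_eq_mul, MonoidAlgebra.single_mul_single,
            inv_mul_cancel, one_mul, TensorProduct.lift.tmul, LinearMap.comp_apply,
            LinearMap.lsmul_apply, hc, act_tmul]
          rw [e, smul_assoc, smul_comm]
        · intro g _ hg
          have : ¬ g⁻¹ * h = 1 := fun H => hg (inv_mul_eq_one.1 H)
          have hc : c (MonoidAlgebra.single (g⁻¹ * h) d) = 0 := by
            change (MonoidAlgebra.single (g⁻¹ * h) d).coeff 1 = 0
            simp [this]
          simp [ε, TensorProduct.smul_tmul', hc]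
        · simp
  refine ⟨TensorProduct.AlgebraTensorModule.lift
    { toFun := fun a => (Algebra.lsmul k k M a) ∘ₗ ε ∘ₗ s.restrictScalars k
      map_add' := fun a b => by ext m; simp
      map_smul' := fun a b => by ext m; simp }, fun m => ?_⟩
  rw [coact_apply, map_sum]
  have := key (s m)
  rw [hs'] at this
  refine Eq.trans (Finset.sum_congr rfl fun g _ => ?_) this
  simp

/-- If `P` is a projective `kG`-module, then so is the cokernel of `P → kG ⊗ₖ P`. -/
theorem projective_coker_coact [Module.Projective (MonoidAlgebra k G) M] :
    Module.Projective (MonoidAlgebra k G)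
      ((MonoidAlgebra k G ⊗[k] M) ⧸ LinearMap.range (coact k G M)) := by
  obtain ⟨r, hr⟩ := exists_retraction_coact k G (M := M)
  refine Module.Projective.of_split
    (Submodule.liftQ _ (LinearMap.id - coact k G M ∘ₗ r) ?_) (Submodule.mkQ _) ?_
  · rintro _ ⟨m, rfl⟩
    simp [hr]
  · refine Submodule.linearMap_qext _ (LinearMap.ext fun x => ?_)
    simp only [LinearMap.comp_apply, Submodule.mkQ_apply, Submodule.liftQ_apply,
      LinearMap.sub_apply, LinearMap.id_apply]
    rw [Submodule.Quotient.mk_sub, sub_eq_self]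
    exact (Submodule.Quotient.mk_eq_zero _).2 ⟨r x, rfl⟩

end Modules

/-! ### The stable module category -/

variable (k G : Type u) [Field k] [Group G]

/-- The category `mod(kG)` of finitely generated `kG`-modules. -/
abbrev FGMod := FGModuleCat.{u} (MonoidAlgebra k G)

/-- Two morphisms of `mod(kG)` are stably equal if their difference factors through a finitely
generated projective `kG`-module. -/
def stableRel : HomRel (FGMod k G) := fun X Y f g =>
  ∃ (P : FGMod k G) (_ : Module.Projective (MonoidAlgebra k G) P) (a : X ⟶ P) (b : P ⟶ Y),
    f - g = a ≫ b

variable {k G} in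
theorem stableRel_add [Fintype G] {X Y : FGMod k G} (f₁ f₂ g₁ g₂ : X ⟶ Y)
    (h₁ : stableRel k G f₁ f₂) (h₂ : stableRel k G g₁ g₂) :
    stableRel k G (f₁ + g₁) (f₂ + g₂) := by
  obtain ⟨P, hP, a, b, h⟩ := h₁
  obtain ⟨Q, hQ, c, d, h'⟩ := h₂
  refine ⟨FGModuleCat.of (MonoidAlgebra k G) (P × Q), ?_,
    FGModuleCat.ofHom (a.hom.hom.prod c.hom.hom),
    FGModuleCat.ofHom (b.hom.hom.coprod d.hom.hom), ?_⟩
  · exact inferInstanceAs (Module.Projective (MonoidAlgebra k G) (P × Q))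
  · rw [add_sub_add_comm, h, h']
    ext x
    rfl

instance [Fintype G] : Congruence (stableRel k G) where
  comp_left := by
    rintro X Y Z f g g' ⟨P, hP, a, b, h⟩
    exact ⟨P, hP, f ≫ a, b, by rw [← Preadditive.comp_sub, h, Category.assoc]⟩
  comp_right := by
    rintro X Y Z f f' g ⟨P, hP, a, b, h⟩
    exact ⟨P, hP, a, b ≫ g, by rw [← Preadditive.sub_comp, h, Category.assoc]⟩
  equivalence := by
    intro X Y
    have hrefl : ∀ f : X ⟶ Y, stableRel k G f f := fun f =>
      ⟨FGModuleCat.of _ PUnit, inferInstanceAs (Module.Projective (MonoidAlgebra k G) PUnit.{u + 1}),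
        0, 0, by simp⟩
    refine ⟨hrefl, ?_, ?_⟩
    · rintro f g ⟨P, hP, a, b, h⟩
      exact ⟨P, hP, -a, b, by rw [Preadditive.neg_comp, ← h, neg_sub]⟩
    · intro f g h h₁ h₂
      have := stableRel_add (f - g) 0 (g - h) 0 (by simpa [stableRel] using h₁)
        (by simpa [stableRel] using h₂)
      simpa [stableRel] using this

variable {k G} in
theorem stableRel_smul (c : k) {X Y : FGMod k G} (f g : X ⟶ Y) (h : stableRel k G f g) :
    stableRel k G (c • f) (c • g) := by
  obtain ⟨P, hP, a, b, h⟩ := h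
  exact ⟨P, hP, c • a, b, by rw [← smul_sub, h, Linear.smul_comp]⟩

variable [Fintype G]

/-- The stable module category `stmod(kG)`: its objects are the finitely generated `kG`-modules,
its morphisms are the `kG`-linear maps modulo those that factor through a projective module. -/
abbrev Stmod := CategoryTheory.Quotient (stableRel k G)

/-- The projection `mod(kG) ⥤ stmod(kG)`. -/
abbrev proj : FGMod k G ⥤ Stmod k G := Quotient.functor (stableRel k G)

instance : Preadditive (Stmod k G) :=
  Quotient.preadditive _ fun _ _ f₁ f₂ g₁ g₂ => stableRel_add f₁ f₂ g₁ g₂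

instance : (proj k G).Additive := Quotient.functor_additive _ _

instance : Linear k (Stmod k G) :=
  Quotient.linear k _ fun c _ _ f g => stableRel_smul c f g

/-- The direct sum of two modules, as a binary bicone in `mod(kG)`. -/
def prodBicone (X Y : FGMod k G) : BinaryBicone X Y where
  pt := FGModuleCat.of (MonoidAlgebra k G) (X × Y)
  fst := FGModuleCat.ofHom (LinearMap.fst (MonoidAlgebra k G) X Y)
  snd := FGModuleCat.ofHom (LinearMap.snd (MonoidAlgebra k G) X Y)
  inl := FGModuleCat.ofHom (LinearMap.inl (MonoidAlgebra k G) X Y)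
  inr := FGModuleCat.ofHom (LinearMap.inr (MonoidAlgebra k G) X Y)
  inl_fst := by ext x; rfl
  inl_snd := by ext x; rfl
  inr_fst := by ext x; rfl
  inr_snd := by ext x; rfl

instance : HasBinaryBiproducts (Stmod k G) where
  has_binary_biproduct := by
    rintro ⟨X⟩ ⟨Y⟩
    refine HasBinaryBiproduct.mk ⟨(proj k G).mapBinaryBicone (prodBicone k G X Y),
      isBinaryBilimitOfTotal _ ?_⟩
    have h : (prodBicone k G X Y).fst ≫ (prodBicone k G X Y).inl +
        (prodBicone k G X Y).snd ≫ (prodBicone k G X Y).inr = 𝟙 (prodBicone k G X Y).pt := by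
      ext x
      change ((x : X × Y).1, (0 : Y)) + ((0 : X), (x : X × Y).2) = (x : X × Y)
      rw [Prod.mk_add_mk, add_zero, zero_add]
      rfl
    have := congrArg (proj k G).map h
    rw [Functor.map_add, Functor.map_comp, Functor.map_comp, CategoryTheory.Functor.map_id] at this
    exact this

/-! ### The functors `Ω` and `Σ = Ω⁻¹` -/

instance (M : FGMod k G) : Module.Finite (MonoidAlgebra k G) (MonoidAlgebra k G ⊗[k] M.obj) := by
  have : Module.Finite k M.obj := Module.Finite.trans (MonoidAlgebra k G) M.obj
  exact Module.Finite.of_restrictScalars_finite k _ _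

instance : IsNoetherianRing (MonoidAlgebra k G) := IsNoetherianRing.of_finite k _

/-- The free `kG`-module `kG ⊗ₖ M`, as an object of `mod(kG)`. -/
def free (M : FGMod k G) : FGMod k G :=
  FGModuleCat.of (MonoidAlgebra k G) (MonoidAlgebra k G ⊗[k] M.obj)

/-- `Ω M`, the kernel of the surjection `kG ⊗ₖ M → M` from a free module. -/
def syzygy : FGMod k G ⥤ FGMod k G where
  obj M := FGModuleCat.of (MonoidAlgebra k G) (LinearMap.ker (act k G M.obj))
  map {M N} f := FGModuleCat.ofHom ((freeMap k G f.hom.hom).restrict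
    (p := LinearMap.ker (act k G M.obj)) (q := LinearMap.ker (act k G N.obj)) fun x hx => by
      rw [LinearMap.mem_ker] at hx ⊢
      rw [act_freeMap, hx, map_zero])
  map_id M := by
    apply FGModuleCat.hom_ext
    refine LinearMap.ext fun x => Subtype.ext ?_
    exact freeMap_id k G x.1
  map_comp f g := by
    apply FGModuleCat.hom_ext
    refine LinearMap.ext fun x => Subtype.ext ?_
    exact freeMap_comp k G f.hom.hom g.hom.hom x.1

/-- `Σ M = Ω⁻¹ M`, the cokernel of the embedding `M → kG ⊗ₖ M` into an injective module. -/
def cosyzygy : FGMod k G ⥤ FGMod k G where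
  obj M := FGModuleCat.of (MonoidAlgebra k G)
    ((MonoidAlgebra k G ⊗[k] M.obj) ⧸ LinearMap.range (coact k G M.obj))
  map {M N} f := FGModuleCat.ofHom (Submodule.mapQ _ _ (freeMap k G f.hom.hom) (by
      rintro _ ⟨m, rfl⟩
      exact ⟨f.hom.hom m, (freeMap_coact k G f.hom.hom m).symm⟩))
  map_id M := by
    apply FGModuleCat.hom_ext
    refine Submodule.linearMap_qext _ (LinearMap.ext fun x => ?_)
    exact congrArg (Submodule.Quotient.mk) (freeMap_id k G x)
  map_comp f g := by
    apply FGModuleCat.hom_ext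
    refine Submodule.linearMap_qext _ (LinearMap.ext fun x => ?_)
    exact congrArg (Submodule.Quotient.mk) (freeMap_comp k G f.hom.hom g.hom.hom x)

instance : (syzygy k G).Additive where
  map_add {M N f g} := by
    apply FGModuleCat.hom_ext
    refine LinearMap.ext fun x => Subtype.ext ?_
    exact freeMap_add k G f.hom.hom g.hom.hom x.1

instance : (cosyzygy k G).Additive where
  map_add {M N f g} := by
    apply FGModuleCat.hom_ext
    refine Submodule.linearMap_qext _ (LinearMap.ext fun x => ?_)
    exact congrArg (Submodule.Quotient.mk) (freeMap_add k G f.hom.hom g.hom.hom x)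

variable {k G} in
theorem stableRel_map (F : FGMod k G ⥤ FGMod k G) [F.Additive]
    (hF : ∀ P : FGMod k G, Module.Projective (MonoidAlgebra k G) P →
      Module.Projective (MonoidAlgebra k G) (F.obj P))
    {X Y : FGMod k G} (f g : X ⟶ Y) (h : stableRel k G f g) :
    (F ⋙ proj k G).map f = (F ⋙ proj k G).map g := by
  obtain ⟨P, hP, a, b, h⟩ := h
  exact CategoryTheory.Quotient.sound _ ⟨F.obj P, hF P hP, F.map a, F.map b, by
    rw [← F.map_sub, h, F.map_comp]⟩

/-- The Heller functor `Ω` on `stmod(kG)`. -/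
def Omega : Stmod k G ⥤ Stmod k G :=
  CategoryTheory.Quotient.lift _ (syzygy k G ⋙ proj k G) fun _ _ f g h =>
    stableRel_map (syzygy k G) (fun _ _ => projective_ker_act k G) f g h

/-- The shift functor `Σ = Ω⁻¹` on `stmod(kG)`. -/
def Sigma : Stmod k G ⥤ Stmod k G :=
  CategoryTheory.Quotient.lift _ (cosyzygy k G ⋙ proj k G) fun _ _ f g h =>
    stableRel_map (cosyzygy k G) (fun _ _ => projective_coker_coact k G) f g h

/-- The `n`-th iterate of an endofunctor. -/
def iterate {C : Type*} [Category C] (F : C ⥤ C) : ℕ → (C ⥤ C)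
  | 0 => 𝟭 C
  | n + 1 => iterate F n ⋙ F

/-- The powers `Σ ^ r` of the shift functor, for `r : ℤ`; a negative power of `Σ` is the
corresponding positive power of `Ω`. -/
def SigmaPow : ℤ → (Stmod k G ⥤ Stmod k G)
  | Int.ofNat n => iterate (Sigma k G) n
  | Int.negSucc n => iterate (Omega k G) (n + 1)

/-- The powers `Ω ^ r = Σ ^ (-r)` of the Heller functor, for `r : ℤ`. -/
def OmegaPow (r : ℤ) : Stmod k G ⥤ Stmod k G := SigmaPow k G (-r)

variable {k G}

/-- The embedding of `M` into the injective module `kG ⊗ₖ M`. -/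
def embed (M : FGMod k G) : M ⟶ free k G M :=
  ConcreteCategory.ofHom (C := FGMod k G) (coact k G M.obj)

/-- The projection of `kG ⊗ₖ M` onto `Σ M`. -/
def toCosyzygy (M : FGMod k G) : free k G M ⟶ (cosyzygy k G).obj M :=
  FGModuleCat.ofHom (Submodule.mkQ (LinearMap.range (coact k G M.obj)))

/-! ### Distinguished triangles, Auslander-Reiten triangles, almost vanishing morphisms -/

/-- `X ⟶ Y ⟶ Z ⟶ Σ X` is a standard triangle, i.e. it arises from a morphism `u : X ⟶ Y` of
`mod(kG)` by forming the pushout `Z` of `u` along the embedding `X ⟶ I` into an injective module: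
```
0 ⟶ X ⟶ I ⟶ Σ X ⟶ 0
    |u   |i   ‖
0 ⟶ Y ⟶ Z ⟶ Σ X ⟶ 0
      v    w
```
-/
def IsStandardTriangle {X Y Z : FGMod k G} (u : X ⟶ Y) (v : Y ⟶ Z)
    (w : Z ⟶ (cosyzygy k G).obj X) : Prop :=
  ∃ i : free k G X ⟶ Z, IsPushout (embed X) u i v ∧ i ≫ w = toCosyzygy X ∧ v ≫ w = 0

/-- The distinguished triangles `X ⟶ Y ⟶ Z ⟶ Σ X` of `stmod(kG)`: those that are isomorphic in
`stmod(kG)` to the image of a standard triangle. -/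
def IsDistinguished {X Y Z : Stmod k G} (u : X ⟶ Y) (v : Y ⟶ Z)
    (w : Z ⟶ (Sigma k G).obj X) : Prop :=
  ∃ (X' Y' Z' : FGMod k G) (u' : X' ⟶ Y') (v' : Y' ⟶ Z') (w' : Z' ⟶ (cosyzygy k G).obj X')
    (a : X ≅ (proj k G).obj X') (b : Y ≅ (proj k G).obj Y') (c : Z ≅ (proj k G).obj Z'),
    IsStandardTriangle u' v' w' ∧
    u ≫ b.hom = a.hom ≫ (proj k G).map u' ∧
    v ≫ c.hom = b.hom ≫ (proj k G).map v' ∧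
    w ≫ (Sigma k G).map a.hom = c.hom ≫ (proj k G).map w'

/-- Auslander-Reiten triangles `X ⟶ Y ⟶ Z ⟶ Σ X` of `stmod(kG)`. -/
structure IsARTriangle {X Y Z : Stmod k G} (u : X ⟶ Y) (v : Y ⟶ Z)
    (w : Z ⟶ (Sigma k G).obj X) : Prop where
  distinguished : IsDistinguished u v w
  indecomposable_left : Indecomposable X
  indecomposable_right : Indecomposable Z
  ne_zero : w ≠ 0
  lift : ∀ {W : Stmod k G} (f : W ⟶ Z), ¬ IsSplitEpi f → ∃ f' : W ⟶ Y, f' ≫ v = f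

/-- A morphism `γ : Z ⟶ T` is almost vanishing if it is the third morphism of an
Auslander-Reiten triangle `X ⟶ Y ⟶ Z ⟶ Σ X`, up to an identification `Σ X ≅ T`. -/
def IsAlmostVanishing {Z T : Stmod k G} (γ : Z ⟶ T) : Prop :=
  ∃ (X Y : Stmod k G) (u : X ⟶ Y) (v : Y ⟶ Z) (w : Z ⟶ (Sigma k G).obj X)
    (e : (Sigma k G).obj X ≅ T), IsARTriangle u v w ∧ γ = w ≫ e.hom

/-! ### Natural transformations from the identity -/

/-- The isomorphism class of an object of `stmod(kG)`. -/
def isoClass (M : Stmod k G) : _root_.Quotient (isIsomorphicSetoid (Stmod k G)) :=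
  _root_.Quotient.mk _ M

/-- The support of a natural transformation `α : F ⟶ F'`: the set of isomorphism classes of
indecomposable objects `M` with `α_M ≠ 0`. -/
def support {F F' : Stmod k G ⥤ Stmod k G} (α : F ⟶ F') :
    Set (_root_.Quotient (isIsomorphicSetoid (Stmod k G))) :=
  {c | ∃ M : Stmod k G, Indecomposable M ∧ α.app M ≠ 0 ∧ c = isoClass M}

/-- `M` is periodic: `Ω ^ n M ≅ M` for some `n > 0`. -/
def IsPeriodic (M : Stmod k G) : Prop :=
  ∃ n : ℕ, 0 < n ∧ Nonempty (M ≅ (OmegaPow k G n).obj M)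

/-- `ψ : Id ⟶ Σ ^ r` is the Linckelmann-Stancu transformation of degree `r` attached to the
periodic indecomposable object `M`, built from an almost vanishing morphism `ζ : M ⟶ Ω M` and
a periodicity isomorphism `θ : Ω M ≅ Σ ^ r M`: its component at `M` is `M ⟶ Ω M ≅ Σ ^ r M`, and it
vanishes on all indecomposable objects that are not isomorphic to `M`. -/
structure IsLinckelmannStancu {r : ℤ} {M : Stmod k G} (ζ : M ⟶ (Omega k G).obj M)
    (θ : (Omega k G).obj M ≅ (SigmaPow k G r).obj M) (ψ : 𝟭 (Stmod k G) ⟶ SigmaPow k G r) :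
    Prop where
  indecomposable : Indecomposable M
  periodic : IsPeriodic M
  almostVanishing : IsAlmostVanishing ζ
  app_self : ψ.app M = ζ ≫ θ.hom
  app_eq_zero : ∀ V : Stmod k G, Indecomposable V → ¬ Nonempty (V ≅ M) → ψ.app V = 0

end

end StMod

/-! Write `F` for `Σ^r`; only that it is an equivalence matters until periodicity is discussed. Two
facts about `φ_M : M ⟶ F M` carry the theorem.

First, `φ_M` is killed by precomposition with every map `f : W ⟶ M` that is not a split epimorphism
(`comp_app_eq_zero_of_not_isSplitEpi`). Decomposing `W`, one may take it indecomposable. If `W` is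
not isomorphic to `M`, then `φ_W = 0` and naturality suffices. Otherwise `f` is a non-invertible
endomorphism of `M`; on a representative of least dimension it factors through an image too small to
have `M` as a stable retract, and `φ` vanishes on that image. Completing `φ_M` to a triangle then
gives an Auslander–Reiten triangle.

Second, Tate duality (`exists_comp_ne_zero`) gives `δ : F M ⟶ Ω M` with `φ_M ≫ δ ≠ 0`. Writing `Ω M
≅ F N` and `δ` as `F g` for some `g : M ⟶ N`, naturality forces `φ_N ≠ 0`, so `N ≅ M` and `F M ≅ Ω
M` (`nonempty_iso_Omega`).

Periodicity follows by cancelling powers of `Ω`, and `φ` is itself a Linckelmann–Stancu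
transformation. Over an algebraically closed field, a map `M ⟶ F M` killed by all non-split
epimorphisms factors as `φ_M ≫ F a`. Subtracting an eigenvalue `c` makes `c - a` non-invertible,
hence killed by `φ_M`, so the map is `c • φ_M` (`exists_smul_app_eq`). -/

namespace StMod

open CategoryTheory.Limits
open scoped TensorProduct ModuleCat

noncomputable section

set_option linter.unusedSectionVars false

/-! ### Transfer maps, Higman's criterion, and injectivity of projectives -/

section Transfer

variable (k G : Type u) [Field k] [Group G]
variable {M N : Type u} [AddCommGroup M] [Module k M] [Module (MonoidAlgebra k G) M]
  [IsScalarTower k (MonoidAlgebra k G) M]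
variable [AddCommGroup N] [Module k N] [Module (MonoidAlgebra k G) N]
  [IsScalarTower k (MonoidAlgebra k G) N]

variable (M) in
/-- The `k`-linear action of a group element on a `kG`-module. -/
def rho (g : G) : M →ₗ[k] M := Algebra.lsmul k k M (MonoidAlgebra.single g (1 : k))

theorem rho_apply (g : G) (m : M) :
    rho k G M g m = (MonoidAlgebra.single g (1 : k) : MonoidAlgebra k G) • m := rfl

theorem rho_one (m : M) : rho k G M 1 m = m := by
  rw [rho_apply, ← MonoidAlgebra.one_def, one_smul]

theorem map_rho (f : M →ₗ[MonoidAlgebra k G] N) (g : G) (m : M) :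
    f (rho k G M g m) = rho k G N g (f m) := by
  simp [rho_apply]

variable (M) in
/-- The coefficient `kG ⊗ₖ M → M` of a tensor at a group element. -/
def coeffAt (g : G) : MonoidAlgebra k G ⊗[k] M →ₗ[k] M :=
  TensorProduct.lift ((LinearMap.lsmul k M).comp
    ({ toFun := fun a => a.coeff g
       map_add' := fun _ _ => rfl
       map_smul' := fun _ _ => rfl } : MonoidAlgebra k G →ₗ[k] k))

theorem coeffAt_tmul (g : G) (a : MonoidAlgebra k G) (m : M) :
    coeffAt k G M g (a ⊗ₜ[k] m) = a.coeff g • m := rfl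

theorem coeffAt_single_tmul [DecidableEq G] (g h : G) (m : M) :
    coeffAt k G M g ((MonoidAlgebra.single h (1 : k) : MonoidAlgebra k G) ⊗ₜ[k] m) =
      if h = g then m else 0 := by
  rw [coeffAt_tmul]
  split_ifs with hh <;> simp [hh]

theorem coeffAt_smul (g h : G) (x : MonoidAlgebra k G ⊗[k] M) :
    coeffAt k G M g ((MonoidAlgebra.single h (1 : k) : MonoidAlgebra k G) • x) =
      coeffAt k G M (h⁻¹ * g) x := by
  induction x with
  | zero => simp
  | add x y hx hy => simp only [smul_add, map_add, hx, hy]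
  | tmul a m =>
    rw [TensorProduct.smul_tmul', coeffAt_tmul, coeffAt_tmul, smul_eq_mul]
    congr 1
    simp

variable [Fintype G]

theorem act_eq_sum (x : MonoidAlgebra k G ⊗[k] M) :
    act k G M x = ∑ g : G, rho k G M g (coeffAt k G M g x) := by
  classical
  induction x with
  | zero => simp
  | add x y hx hy => simp only [map_add, hx, hy, Finset.sum_add_distrib]
  | tmul a m =>
    induction a using MonoidAlgebra.induction_linear with
    | zero => simp
    | add a b ha hb => simp only [TensorProduct.add_tmul, map_add, Finset.sum_add_distrib, ha, hb]
    | single h d =>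
      have e : (MonoidAlgebra.single h d : MonoidAlgebra k G)
          = d • MonoidAlgebra.single h 1 := by simp
      simp only [e, ← TensorProduct.smul_tmul', map_smul, coeffAt_single_tmul]
      rw [Finset.sum_eq_single h]
      · have : act k G M (d • (MonoidAlgebra.single h (1 : k) ⊗ₜ[k] m)) =
            d • (MonoidAlgebra.single h (1 : k) : MonoidAlgebra k G) • m := by
          rw [TensorProduct.smul_tmul', act_tmul, smul_assoc]
        rw [this]
        simp [rho_apply]
      · intro g _ hg
        simp [Ne.symm hg]
      · simp

theorem coeffAt_one_coact (m : M) : coeffAt k G M 1 (coact k G M m) = m := by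
  classical
  rw [coact_apply, map_sum, Finset.sum_eq_single 1]
  · rw [coeffAt_single_tmul, if_pos rfl, inv_one, ← MonoidAlgebra.one_def, one_smul]
  · intro g _ hg
    rw [coeffAt_single_tmul, if_neg hg]
  · simp

theorem coact_injective : Function.Injective (coact k G M) :=
  Function.LeftInverse.injective (coeffAt_one_coact k G)

theorem act_surjective : Function.Surjective (act k G M) := fun m => ⟨1 ⊗ₜ m, by simp⟩

/-- The `kG`-linear map `M → kG ⊗ₖ N`, `m ↦ ∑ g, g ⊗ u (g⁻¹ m)` attached to a `k`-linear map
`u : M → N`. -/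
def coind (u : M →ₗ[k] N) : M →ₗ[MonoidAlgebra k G] MonoidAlgebra k G ⊗[k] N :=
  (TensorProduct.AlgebraTensorModule.map LinearMap.id u) ∘ₗ coact k G M

theorem coind_apply (u : M →ₗ[k] N) (m : M) :
    coind k G u m = ∑ g : G, (MonoidAlgebra.single g (1 : k)) ⊗ₜ[k] u (rho k G M g⁻¹ m) := by
  simp [coind, coact_apply, rho_apply]

theorem coeffAt_one_coind (u : M →ₗ[k] N) (m : M) : coeffAt k G N 1 (coind k G u m) = u m := by
  classical
  rw [coind_apply, map_sum, Finset.sum_eq_single 1]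
  · rw [coeffAt_single_tmul, if_pos rfl, inv_one, rho_one]
  · intro g _ hg
    rw [coeffAt_single_tmul, if_neg hg]
  · simp

/-- The transfer `∑ g, g u g⁻¹` of a `k`-linear map between `kG`-modules. -/
def transfer : (M →ₗ[k] N) →ₗ[k] (M →ₗ[k] N) where
  toFun u := ∑ g : G, rho k G N g ∘ₗ u ∘ₗ rho k G M g⁻¹
  map_add' u v := by
    simp [LinearMap.add_comp, LinearMap.comp_add, Finset.sum_add_distrib]
  map_smul' c u := by
    simp [LinearMap.smul_comp, LinearMap.comp_smul, Finset.smul_sum]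

theorem transfer_apply (u : M →ₗ[k] N) (m : M) :
    transfer k G u m = ∑ g : G, rho k G N g (u (rho k G M g⁻¹ m)) := by
  simp [transfer]

/-- This has two uses: a transfer factors through a free module, and a `u` with zero transfer yields
a `kG`-map into the kernel of the action map, that is, into a syzygy. -/
theorem act_coind (u : M →ₗ[k] N) (m : M) : act k G N (coind k G u m) = transfer k G u m := by
  simp [coind_apply, transfer_apply, rho_apply]

/-- Higman's criterion: a `kG`-linear map that factors through a projective module is a transfer. -/
theorem exists_transfer_eq_of_factors {P : Type u} [AddCommGroup P] [Module k P]
    [Module (MonoidAlgebra k G) P] [IsScalarTower k (MonoidAlgebra k G) P]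
    [Module.Projective (MonoidAlgebra k G) P]
    (a : M →ₗ[MonoidAlgebra k G] P) (b : P →ₗ[MonoidAlgebra k G] N) :
    ∃ u : M →ₗ[k] N, ∀ m, transfer k G u m = b (a m) := by
  obtain ⟨r, hr⟩ := exists_retraction_coact k G (M := P)
  -- The identity of `P` is the transfer of `p ↦ r (1 ⊗ p)`, because `g ⊗ g⁻¹ p = g (1 ⊗ g⁻¹ p)` and
  -- `r` retracts the coaction. Composing with `a` and `b` gives the witness.
  refine ⟨b.restrictScalars k ∘ₗ r.restrictScalars k ∘ₗ
    (TensorProduct.mk k (MonoidAlgebra k G) P 1) ∘ₗ a.restrictScalars k, fun m => ?_⟩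
  rw [transfer_apply]
  conv_rhs => rw [← hr (a m), coact_apply, map_sum, map_sum]
  refine Finset.sum_congr rfl fun g _ => ?_
  simp only [LinearMap.comp_apply, LinearMap.restrictScalars_apply, TensorProduct.mk_apply,
    ← map_rho]
  simp only [rho_apply, TensorProduct.smul_tmul', map_smul, smul_eq_mul, mul_one]

/-- A projective `kG`-module is injective. -/
theorem exists_extension_of_projective {P : Type u} [AddCommGroup P] [Module k P]
    [Module (MonoidAlgebra k G) P] [IsScalarTower k (MonoidAlgebra k G) P]
    [Module.Projective (MonoidAlgebra k G) P]
    (i : M →ₗ[MonoidAlgebra k G] N) (hi : Function.Injective i) (a : M →ₗ[MonoidAlgebra k G] P) :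
    ∃ b : N →ₗ[MonoidAlgebra k G] P, b ∘ₗ i = a := by
  obtain ⟨r, hr⟩ := exists_retraction_coact k G (M := P)
  obtain ⟨s, hs⟩ := (i.restrictScalars k).exists_leftInverse_of_injective
    (LinearMap.ker_eq_bot.2 hi)
  -- The splitting `s` is only `k`-linear; `coind` makes the extension equivariant, and `r` brings
  -- it back to `P`.
  refine ⟨r ∘ₗ coind k G (a.restrictScalars k ∘ₗ s), LinearMap.ext fun m => ?_⟩
  have hs' : ∀ m, s (i m) = m := fun m => LinearMap.congr_fun hs m
  conv_rhs => rw [← hr (a m), coact_apply]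
  simp only [LinearMap.comp_apply, coind_apply, ← map_rho, hs', LinearMap.restrictScalars_apply]
  simp [rho_apply]

/-- Cyclicity of the trace moves each group element to the other side, and inverting the summation
index makes transfer self-adjoint for the trace pairing. -/
theorem trace_comp_transfer [Module.Finite k M] [Module.Finite k N] (u : N →ₗ[k] M)
    (h : M →ₗ[k] N) :
    LinearMap.trace k M (u ∘ₗ transfer k G h) = LinearMap.trace k M (transfer k G u ∘ₗ h) := by
  have e1 : u ∘ₗ transfer k G h =
      ∑ g : G, (u ∘ₗ rho k G N g ∘ₗ h) ∘ₗ rho k G M g⁻¹ := by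
    ext m; simp [transfer_apply]
  have e2 : transfer k G u ∘ₗ h =
      ∑ g : G, rho k G M g ∘ₗ (u ∘ₗ rho k G N g⁻¹ ∘ₗ h) := by
    ext m; simp [transfer_apply]
  rw [e1, e2, map_sum, map_sum]
  refine Fintype.sum_equiv (Equiv.inv G) _ _ fun g => ?_
  rw [LinearMap.trace_comp_comm']
  simp

end Transfer

/-! ### Non-degeneracy of the trace pairing -/

section TracePairing

variable {k V W : Type*} [Field k] [AddCommGroup V] [Module k V] [AddCommGroup W] [Module k W]
  [Module.Finite k V] [Module.Finite k W]

/-- Rank-one test maps `v ↦ f v • w` suffice: the trace of the composite is `f (u w)`. -/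
theorem eq_zero_of_trace_comp_eq_zero (u : W →ₗ[k] V)
    (hu : ∀ h : V →ₗ[k] W, LinearMap.trace k V (u ∘ₗ h) = 0) : u = 0 := by
  ext w
  by_contra hw
  obtain ⟨f, hf⟩ : ∃ f : V →ₗ[k] k, f (u w) ≠ 0 := by
    by_contra! H
    exact hw ((Module.forall_dual_apply_eq_zero_iff k _).1 H)
  refine hf ?_
  rw [← hu (f.smulRight w), ← LinearMap.trace_smulRight]
  congr 1
  ext v
  simp

/-- The pairing embeds one Hom space into the dual of the other, and the dimensions agree. -/
theorem exists_trace_comp_eq (F : (V →ₗ[k] W) →ₗ[k] k) :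
    ∃ u : W →ₗ[k] V, ∀ h, LinearMap.trace k V (u ∘ₗ h) = F h := by
  let Φ : (W →ₗ[k] V) →ₗ[k] Module.Dual k (V →ₗ[k] W) :=
    LinearMap.mk₂ k (fun u h => LinearMap.trace k V (u ∘ₗ h))
      (fun _ _ _ => by simp [LinearMap.add_comp]) (fun _ _ _ => by simp [LinearMap.smul_comp])
      (fun _ _ _ => by simp [LinearMap.comp_add]) (fun _ _ _ => by simp [LinearMap.comp_smul])
  have hinj : Function.Injective Φ := by
    rw [← LinearMap.ker_eq_bot, LinearMap.ker_eq_bot']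
    exact fun u hu => eq_zero_of_trace_comp_eq_zero u fun h => LinearMap.congr_fun hu h
  have hsurj := (LinearMap.injective_iff_surjective_of_finrank_eq_finrank (by
    rw [Subspace.dual_finrank_eq, Module.finrank_linearMap, Module.finrank_linearMap,
      mul_comm])).1 hinj
  obtain ⟨u, hu⟩ := hsurj F
  exact ⟨u, fun h => LinearMap.congr_fun hu h⟩

end TracePairing

/-! ### Tate duality at the level of modules -/

section TateDuality

variable (k G : Type u) [Field k] [Group G] [Fintype G]
variable {M N : Type u} [AddCommGroup M] [Module k M] [Module (MonoidAlgebra k G) M]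
  [IsScalarTower k (MonoidAlgebra k G) M] [Module.Finite k M]
variable [AddCommGroup N] [Module k N] [Module (MonoidAlgebra k G) N]
  [IsScalarTower k (MonoidAlgebra k G) N] [Module.Finite k N]

/-- Tate duality: a `kG`-linear map `γ : M → N` that is not a transfer is detected by some map
`N → Ω M`. -/
theorem exists_comp_ne_transfer (γ : M →ₗ[MonoidAlgebra k G] N)
    (hγ : ∀ h : M →ₗ[k] N, ¬ ∀ m, transfer k G h m = γ m) :
    ∃ δ : N →ₗ[MonoidAlgebra k G] LinearMap.ker (act k G M),
      ∀ h : M →ₗ[k] LinearMap.ker (act k G M), ¬ ∀ m, transfer k G h m = δ (γ m) := by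
  have hmem : γ.restrictScalars k ∉ LinearMap.range (transfer k G (M := M) (N := N)) := by
    rintro ⟨h, hh⟩
    exact hγ h fun m => LinearMap.congr_fun hh m
  obtain ⟨F, hF, hle⟩ := Submodule.exists_le_ker_of_notMem hmem
  obtain ⟨u, hu⟩ := exists_trace_comp_eq F
  -- The functional `tr (u ∘ -)` kills all transfers, so by adjointness `u` has zero transfer; hence
  -- `coind u` lands in `Ω M` and serves as `δ`.
  have hTu : transfer k G u = 0 := by
    refine eq_zero_of_trace_comp_eq_zero _ fun h => ?_
    rw [← trace_comp_transfer, hu]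
    exact hle ⟨h, rfl⟩
  refine ⟨LinearMap.codRestrict _ (coind k G u) fun n => ?_, fun h hh => hF ?_⟩
  · rw [LinearMap.mem_ker, act_coind, hTu, LinearMap.zero_apply]
  · rw [← hu]
    let h' : M →ₗ[k] MonoidAlgebra k G ⊗[k] M :=
      (LinearMap.ker (act k G M)).subtype.restrictScalars k ∘ₗ h
    -- Reading the supposed identity `transfer h = δ ∘ γ` at the coefficient of `1` recovers `u ∘
    -- γ`. By cyclicity its trace is that of `∑ g, g ∘ coeff_g ∘ h'`, which is the action map after
    -- `h'` and vanishes because `h` takes values in its kernel. This contradicts the choice of the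
    -- functional.
    have key : u ∘ₗ γ.restrictScalars k =
        ∑ g : G, (coeffAt k G M g ∘ₗ h') ∘ₗ rho k G M g := by
      ext m
      have := congrArg (fun x : LinearMap.ker (act k G M) => coeffAt k G M 1 x.1) (hh m)
      simp only [LinearMap.codRestrict_apply, coeffAt_one_coind] at this
      simp only [LinearMap.comp_apply, LinearMap.restrictScalars_apply, LinearMap.sum_apply]
      rw [← this, transfer_apply, Submodule.coe_sum, map_sum]
      refine Fintype.sum_equiv (Equiv.inv G) _ _ fun g => ?_
      rw [rho_apply, Submodule.coe_smul, coeffAt_smul]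
      simp [h']
    have hact : ∑ g : G, rho k G M g ∘ₗ (coeffAt k G M g ∘ₗ h') = 0 := by
      ext m
      simp only [LinearMap.sum_apply, LinearMap.comp_apply, ← act_eq_sum]
      exact (h m).2
    rw [key, map_sum]
    simp_rw [LinearMap.trace_comp_comm' (rho k G M _)]
    rw [← map_sum, hact, map_zero]

theorem exists_comp_not_factors (γ : M →ₗ[MonoidAlgebra k G] N)
    (hγ : ∀ h : M →ₗ[k] N, ¬ ∀ m, transfer k G h m = γ m) :
    ∃ δ : N →ₗ[MonoidAlgebra k G] LinearMap.ker (act k G M),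
      ∀ (P : Type u) [AddCommGroup P] [Module k P] [Module (MonoidAlgebra k G) P]
        [IsScalarTower k (MonoidAlgebra k G) P] [Module.Projective (MonoidAlgebra k G) P]
        (a : M →ₗ[MonoidAlgebra k G] P)
        (b : P →ₗ[MonoidAlgebra k G] LinearMap.ker (act k G M)), δ ∘ₗ γ ≠ b ∘ₗ a := by
  obtain ⟨δ, hδ⟩ := exists_comp_ne_transfer k G γ hγ
  refine ⟨δ, fun P _ _ _ _ _ a b hab => ?_⟩
  obtain ⟨u, hu⟩ := exists_transfer_eq_of_factors k G (N := LinearMap.ker (act k G M)) a b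
  exact hδ u fun m => (hu m).trans (LinearMap.congr_fun hab m).symm

end TateDuality

variable {k G : Type u} [Field k] [Group G] [Fintype G]

/-! ### Short exact sequences with projective middle term -/

section ExactSequences

theorem proj_map_eq_zero_iff {X Y : FGMod k G} (f : X ⟶ Y) :
    (proj k G).map f = 0 ↔
      ∃ (P : FGMod k G) (_ : Module.Projective (MonoidAlgebra k G) P) (a : X ⟶ P) (b : P ⟶ Y),
        f = a ≫ b := by
  rw [← (proj k G).map_zero, Quotient.functor_map_eq_iff]
  simp [stableRel]

theorem proj_map_eq_zero_of_factors {X Y P : FGMod k G}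
    (hP : Module.Projective (MonoidAlgebra k G) P) (a : X ⟶ P) (b : P ⟶ Y) :
    (proj k G).map (a ≫ b) = 0 :=
  (proj_map_eq_zero_iff _).2 ⟨P, hP, a, b, rfl⟩

/-- Lifting along an epimorphism from a projective module. -/
theorem exists_lift {P E B : FGMod k G} (hP : Module.Projective (MonoidAlgebra k G) P)
    (p : E ⟶ B) (hp : Function.Surjective p.hom.hom) (f : P ⟶ B) : ∃ l : P ⟶ E, l ≫ p = f := by
  obtain ⟨l, hl⟩ := Module.projective_lifting_property p.hom.hom f.hom.hom hp
  exact ⟨ConcreteCategory.ofHom (C := FGMod k G) l, FGModuleCat.hom_ext hl⟩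

/-- Extension along a monomorphism to a projective module. -/
theorem exists_extend {P A E : FGMod k G} (hP : Module.Projective (MonoidAlgebra k G) P)
    (i : A ⟶ E) (hi : Function.Injective i.hom.hom) (f : A ⟶ P) : ∃ l : E ⟶ P, i ≫ l = f := by
  obtain ⟨l, hl⟩ := exists_extension_of_projective k G (P := P.obj) i.hom.hom hi f.hom.hom
  exact ⟨ConcreteCategory.ofHom (C := FGMod k G) l, FGModuleCat.hom_ext hl⟩

/-- Short exact sequences `0 ⟶ A ⟶ E ⟶ B ⟶ 0` of `kG`-modules. -/
structure IsShortExact {A E B : FGMod k G} (i : A ⟶ E) (p : E ⟶ B) : Prop where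
  injective : Function.Injective i.hom.hom
  surjective : Function.Surjective p.hom.hom
  range_eq_ker : LinearMap.range i.hom.hom = LinearMap.ker p.hom.hom

namespace IsShortExact

variable {A E B : FGMod k G} {i : A ⟶ E} {p : E ⟶ B}

theorem comp_eq_zero (h : IsShortExact i p) : i ≫ p = 0 := by
  refine FGModuleCat.hom_ext (LinearMap.ext fun x => ?_)
  have : i.hom.hom x ∈ LinearMap.ker p.hom.hom := h.range_eq_ker ▸ LinearMap.mem_range_self _ x
  exact this

theorem exists_desc (h : IsShortExact i p) {Y : FGMod k G} (f : E ⟶ Y) (hf : i ≫ f = 0) :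
    ∃ d : B ⟶ Y, p ≫ d = f := by
  let e := p.hom.hom.quotKerEquivOfSurjective h.surjective
  have hle : LinearMap.ker p.hom.hom ≤ LinearMap.ker f.hom.hom := by
    rw [← h.range_eq_ker]
    rintro _ ⟨x, rfl⟩
    exact congrArg (fun g : A ⟶ Y => g.hom.hom x) hf
  refine ⟨ConcreteCategory.ofHom (C := FGMod k G)
    (((LinearMap.ker p.hom.hom).liftQ f.hom.hom hle) ∘ₗ e.symm.toLinearMap),
    FGModuleCat.hom_ext (LinearMap.ext fun x => ?_)⟩
  have hx : e.symm (p.hom.hom x) = Submodule.Quotient.mk x := by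
    rw [LinearEquiv.symm_apply_eq]
    rfl
  change (LinearMap.ker p.hom.hom).liftQ f.hom.hom hle (e.symm (p.hom.hom x)) = _
  rw [hx]
  rfl

theorem exists_factor (h : IsShortExact i p) {Y : FGMod k G} (f : Y ⟶ E) (hf : f ≫ p = 0) :
    ∃ d : Y ⟶ A, d ≫ i = f := by
  let e := LinearEquiv.ofInjective i.hom.hom h.injective
  have hmem : ∀ y, f.hom.hom y ∈ LinearMap.range i.hom.hom := fun y => by
    rw [h.range_eq_ker]
    exact congrArg (fun g : Y ⟶ B => g.hom.hom y) hf
  refine ⟨ConcreteCategory.ofHom (C := FGMod k G)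
    (e.symm.toLinearMap ∘ₗ f.hom.hom.codRestrict _ hmem),
    FGModuleCat.hom_ext (LinearMap.ext fun y => ?_)⟩
  exact congrArg Subtype.val (e.apply_symm_apply ⟨f.hom.hom y, hmem y⟩)

variable {A' E' B' : FGMod k G} {i' : A' ⟶ E'} {p' : E' ⟶ B'}

theorem exists_map_of_left (h : IsShortExact i p) (h' : IsShortExact i' p')
    (hE' : Module.Projective (MonoidAlgebra k G) E') (a : A ⟶ A') :
    ∃ (e : E ⟶ E') (b : B ⟶ B'), i ≫ e = a ≫ i' ∧ e ≫ p' = p ≫ b := by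
  obtain ⟨e, he⟩ := exists_extend hE' i h.injective (a ≫ i')
  obtain ⟨b, hb⟩ := h.exists_desc (e ≫ p') (by
    rw [← Category.assoc, he, Category.assoc, h'.comp_eq_zero, comp_zero])
  exact ⟨e, b, he, hb.symm⟩

theorem exists_map_of_right (h : IsShortExact i p) (h' : IsShortExact i' p')
    (hE : Module.Projective (MonoidAlgebra k G) E) (b : B ⟶ B') :
    ∃ (a : A ⟶ A') (e : E ⟶ E'), i ≫ e = a ≫ i' ∧ e ≫ p' = p ≫ b := by
  obtain ⟨e, he⟩ := exists_lift hE p' h'.surjective (p ≫ b)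
  obtain ⟨a, ha⟩ := h'.exists_factor (i ≫ e) (by
    rw [Category.assoc, he, ← Category.assoc, h.comp_eq_zero, zero_comp])
  exact ⟨a, e, ha.symm, he⟩

/-- The factorisation of `a` through `P` extends to `E` since `P` is injective. Correcting `e` by
this extension kills it on `A`, so it descends to `B`, and `b` then factors through the projective
`E'`. `left_eq_zero` is the dual argument with lifts. -/
theorem right_eq_zero (h : IsShortExact i p)
    (hE' : Module.Projective (MonoidAlgebra k G) E') (h' : IsShortExact i' p')
    {a : A ⟶ A'} {e : E ⟶ E'} {b : B ⟶ B'} (hl : i ≫ e = a ≫ i') (hr : e ≫ p' = p ≫ b)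
    (ha : (proj k G).map a = 0) : (proj k G).map b = 0 := by
  obtain ⟨P, hP, x, y, rfl⟩ := (proj_map_eq_zero_iff a).1 ha
  obtain ⟨c, hc⟩ := exists_extend hP i h.injective x
  obtain ⟨d, hd⟩ := h.exists_desc (e - c ≫ y ≫ i') (by
    rw [Preadditive.comp_sub, hl, ← Category.assoc i, hc, Category.assoc, sub_self])
  have : b = d ≫ p' := by
    have hp : Epi p := ConcreteCategory.epi_of_surjective p h.surjective
    rw [← cancel_epi p, ← hr, ← Category.assoc, hd, Preadditive.sub_comp, Category.assoc,
      Category.assoc, h'.comp_eq_zero, comp_zero, comp_zero, sub_zero]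
  rw [this]
  exact proj_map_eq_zero_of_factors hE' _ _

theorem left_eq_zero (h : IsShortExact i p)
    (hE : Module.Projective (MonoidAlgebra k G) E) (h' : IsShortExact i' p')
    {a : A ⟶ A'} {e : E ⟶ E'} {b : B ⟶ B'} (hl : i ≫ e = a ≫ i') (hr : e ≫ p' = p ≫ b)
    (hb : (proj k G).map b = 0) : (proj k G).map a = 0 := by
  obtain ⟨P, hP, x, y, rfl⟩ := (proj_map_eq_zero_iff b).1 hb
  obtain ⟨c, hc⟩ := exists_lift hP p' h'.surjective y
  obtain ⟨d, hd⟩ := h'.exists_factor (e - p ≫ x ≫ c) (by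
    rw [Preadditive.sub_comp, hr, Category.assoc, Category.assoc, hc, sub_self])
  have : a = i ≫ d := by
    have hi : Mono i' := ConcreteCategory.mono_of_injective i' h'.injective
    rw [← cancel_mono i', ← hl, Category.assoc, hd, Preadditive.comp_sub, ← Category.assoc i p,
      h.comp_eq_zero, zero_comp, sub_zero]
  rw [this]
  exact proj_map_eq_zero_of_factors hE _ _

theorem right_eq (h : IsShortExact i p)
    (hE' : Module.Projective (MonoidAlgebra k G) E') (h' : IsShortExact i' p')
    {a : A ⟶ A'} {e₁ e₂ : E ⟶ E'} {b₁ b₂ : B ⟶ B'}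
    (hl₁ : i ≫ e₁ = a ≫ i') (hr₁ : e₁ ≫ p' = p ≫ b₁)
    (hl₂ : i ≫ e₂ = a ≫ i') (hr₂ : e₂ ≫ p' = p ≫ b₂) :
    (proj k G).map b₁ = (proj k G).map b₂ := by
  rw [← sub_eq_zero, ← Functor.map_sub]
  refine h.right_eq_zero hE' h' (a := 0) (e := e₁ - e₂) ?_ ?_ (Functor.map_zero _ _ _)
  · rw [Preadditive.comp_sub, hl₁, hl₂, sub_self, zero_comp]
  · rw [Preadditive.sub_comp, Preadditive.comp_sub, hr₁, hr₂]

theorem left_eq (h : IsShortExact i p)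
    (hE : Module.Projective (MonoidAlgebra k G) E) (h' : IsShortExact i' p')
    {a₁ a₂ : A ⟶ A'} {e₁ e₂ : E ⟶ E'} {b : B ⟶ B'}
    (hl₁ : i ≫ e₁ = a₁ ≫ i') (hr₁ : e₁ ≫ p' = p ≫ b)
    (hl₂ : i ≫ e₂ = a₂ ≫ i') (hr₂ : e₂ ≫ p' = p ≫ b) :
    (proj k G).map a₁ = (proj k G).map a₂ := by
  rw [← sub_eq_zero, ← Functor.map_sub]
  refine h.left_eq_zero hE h' (b := 0) (e := e₁ - e₂) ?_ ?_ (Functor.map_zero _ _ _)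
  · rw [Preadditive.comp_sub, Preadditive.sub_comp, hl₁, hl₂]
  · rw [Preadditive.sub_comp, hr₁, hr₂, sub_self, comp_zero]

/-- Schanuel's lemma in stable form: the identity of `A` induces maps in both directions, and their
composites agree stably with identities by the uniqueness in `right_eq`. -/
theorem nonempty_iso_right {p' : E' ⟶ B'} {i' : A ⟶ E'}
    (h : IsShortExact i p) (h' : IsShortExact i' p')
    (hE : Module.Projective (MonoidAlgebra k G) E)
    (hE' : Module.Projective (MonoidAlgebra k G) E') :
    Nonempty ((proj k G).obj B ≅ (proj k G).obj B') := by
  obtain ⟨e, b, h₁, h₂⟩ := h.exists_map_of_left h' hE' (𝟙 A)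
  obtain ⟨e', b', h₃, h₄⟩ := h'.exists_map_of_left h hE (𝟙 A)
  rw [Category.id_comp] at h₁ h₃
  refine ⟨⟨(proj k G).map b, (proj k G).map b', ?_, ?_⟩⟩
  · rw [← Functor.map_comp, ← CategoryTheory.Functor.map_id]
    refine h.right_eq (a := 𝟙 A) (e₁ := e ≫ e') (e₂ := 𝟙 E) hE h ?_ ?_ (by simp) (by simp)
    · rw [← Category.assoc, h₁, h₃, Category.id_comp]
    · rw [Category.assoc, h₄, ← Category.assoc, h₂, Category.assoc]
  · rw [← Functor.map_comp, ← CategoryTheory.Functor.map_id]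
    refine h'.right_eq (a := 𝟙 A) (e₁ := e' ≫ e) (e₂ := 𝟙 E') hE' h' ?_ ?_ (by simp) (by simp)
    · rw [← Category.assoc, h₃, h₁, Category.id_comp]
    · rw [Category.assoc, h₂, ← Category.assoc, h₄, Category.assoc]

theorem nonempty_iso_left {p' : E' ⟶ B} {i' : A' ⟶ E'}
    (h : IsShortExact i p) (h' : IsShortExact i' p')
    (hE : Module.Projective (MonoidAlgebra k G) E)
    (hE' : Module.Projective (MonoidAlgebra k G) E') :
    Nonempty ((proj k G).obj A ≅ (proj k G).obj A') := by
  obtain ⟨b, e, h₁, h₂⟩ := h.exists_map_of_right h' hE (𝟙 B)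
  obtain ⟨b', e', h₃, h₄⟩ := h'.exists_map_of_right h hE' (𝟙 B)
  rw [Category.comp_id] at h₂ h₄
  refine ⟨⟨(proj k G).map b, (proj k G).map b', ?_, ?_⟩⟩
  · rw [← Functor.map_comp, ← CategoryTheory.Functor.map_id]
    refine h.left_eq (b := 𝟙 B) (e₁ := e ≫ e') (e₂ := 𝟙 E) hE h ?_ ?_ (by simp) (by simp)
    · rw [← Category.assoc, h₁, Category.assoc, h₃, Category.assoc]
    · rw [Category.assoc, h₄, h₂, Category.comp_id]
  · rw [← Functor.map_comp, ← CategoryTheory.Functor.map_id]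
    refine h'.left_eq (b := 𝟙 B) (e₁ := e' ≫ e) (e₂ := 𝟙 E') hE' h' ?_ ?_ (by simp) (by simp)
    · rw [← Category.assoc, h₃, Category.assoc, h₁, Category.assoc]
    · rw [Category.assoc, h₂, h₄, Category.comp_id]

end IsShortExact

end ExactSequences

/-! ### `Ω` and `Σ` are mutually inverse equivalences -/

section Shift

/-- The inclusion of `Ω M` into the free module `kG ⊗ₖ M`. -/
def fromSyzygy (M : FGMod k G) : (syzygy k G).obj M ⟶ free k G M :=
  FGModuleCat.ofHom (LinearMap.ker (act k G M.obj)).subtype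

/-- The projection of the free module `kG ⊗ₖ M` onto `M`. -/
def project (M : FGMod k G) : free k G M ⟶ M :=
  ConcreteCategory.ofHom (C := FGMod k G) (act k G M.obj)

theorem projective_free (M : FGMod k G) : Module.Projective (MonoidAlgebra k G) (free k G M) :=
  inferInstanceAs (Module.Projective (MonoidAlgebra k G) (MonoidAlgebra k G ⊗[k] M.obj))

theorem isShortExact_syzygy (M : FGMod k G) : IsShortExact (fromSyzygy M) (project M) where
  injective := Subtype.val_injective
  surjective := act_surjective k G
  range_eq_ker := Submodule.range_subtype _

theorem isShortExact_cosyzygy (M : FGMod k G) : IsShortExact (embed M) (toCosyzygy M) where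
  injective := coact_injective k G
  surjective := Submodule.mkQ_surjective _
  range_eq_ker := (Submodule.ker_mkQ _).symm

/-- The map of free modules induced by a map of `kG`-modules. -/
def freeHom {M N : FGMod k G} (f : M ⟶ N) : free k G M ⟶ free k G N :=
  FGModuleCat.ofHom (freeMap k G f.hom.hom)

theorem syzygy_map_fromSyzygy {M N : FGMod k G} (f : M ⟶ N) :
    fromSyzygy M ≫ freeHom f = (syzygy k G).map f ≫ fromSyzygy N := rfl

theorem freeHom_project {M N : FGMod k G} (f : M ⟶ N) :
    freeHom f ≫ project N = project M ≫ f :=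
  FGModuleCat.hom_ext (LinearMap.ext (act_freeMap k G f.hom.hom))

theorem embed_freeHom {M N : FGMod k G} (f : M ⟶ N) :
    embed M ≫ freeHom f = f ≫ embed N :=
  FGModuleCat.hom_ext (LinearMap.ext (freeMap_coact k G f.hom.hom))

theorem freeHom_toCosyzygy {M N : FGMod k G} (f : M ⟶ N) :
    freeHom f ≫ toCosyzygy N = toCosyzygy M ≫ (cosyzygy k G).map f := rfl

instance : (Omega k G).Additive where
  map_add {X Y f g} := by
    obtain ⟨f, rfl⟩ := (proj k G).map_surjective (X := X.as) (Y := Y.as) f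
    obtain ⟨g, rfl⟩ := (proj k G).map_surjective (X := X.as) (Y := Y.as) g
    rw [← Functor.map_add]
    exact (syzygy k G ⋙ proj k G).map_add

instance : (Sigma k G).Additive where
  map_add {X Y f g} := by
    obtain ⟨f, rfl⟩ := (proj k G).map_surjective (X := X.as) (Y := Y.as) f
    obtain ⟨g, rfl⟩ := (proj k G).map_surjective (X := X.as) (Y := Y.as) g
    rw [← Functor.map_add]
    exact (cosyzygy k G ⋙ proj k G).map_add

/-- Both sides are cokernels of embeddings of `Ω X` into free modules. Only objectwise isomorphisms
are needed, so no naturality is proved. -/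
theorem nonempty_Sigma_Omega_iso (X : Stmod k G) :
    Nonempty ((Sigma k G).obj ((Omega k G).obj X) ≅ X) :=
  (isShortExact_cosyzygy ((syzygy k G).obj X.as)).nonempty_iso_right (isShortExact_syzygy X.as)
    (projective_free _) (projective_free _)

theorem nonempty_Omega_Sigma_iso (X : Stmod k G) :
    Nonempty ((Omega k G).obj ((Sigma k G).obj X) ≅ X) :=
  (isShortExact_syzygy ((cosyzygy k G).obj X.as)).nonempty_iso_left (isShortExact_cosyzygy X.as)
    (projective_free _) (projective_free _)

/-- A map between cosyzygies lifts to the middle terms and restricts to the left ones; the cosyzygy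
of that restriction is stably the given map, since both complete the same left-hand map. -/
instance : (Sigma k G).Full where
  map_surjective {X Y} g := by
    obtain ⟨g, rfl⟩ := (proj k G).map_surjective (X := (cosyzygy k G).obj X.as)
      (Y := (cosyzygy k G).obj Y.as) g
    obtain ⟨a, e, h₁, h₂⟩ := (isShortExact_cosyzygy X.as).exists_map_of_right
      (isShortExact_cosyzygy Y.as) (projective_free _) g
    exact ⟨(proj k G).map a, (isShortExact_cosyzygy X.as).right_eq (projective_free _)
      (isShortExact_cosyzygy Y.as) (embed_freeHom a) (freeHom_toCosyzygy a) h₁ h₂⟩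

instance : (Omega k G).Full where
  map_surjective {X Y} g := by
    obtain ⟨g, rfl⟩ := (proj k G).map_surjective (X := (syzygy k G).obj X.as)
      (Y := (syzygy k G).obj Y.as) g
    obtain ⟨e, b, h₁, h₂⟩ := (isShortExact_syzygy X.as).exists_map_of_left
      (isShortExact_syzygy Y.as) (projective_free _) g
    exact ⟨(proj k G).map b, (isShortExact_syzygy X.as).left_eq (projective_free _)
      (isShortExact_syzygy Y.as) (syzygy_map_fromSyzygy b) (freeHom_project b) h₁ h₂⟩

instance : (Sigma k G).Faithful where
  map_injective {X Y f g} h := by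
    obtain ⟨f, rfl⟩ := (proj k G).map_surjective (X := X.as) (Y := Y.as) f
    obtain ⟨g, rfl⟩ := (proj k G).map_surjective (X := X.as) (Y := Y.as) g
    rw [← sub_eq_zero, ← Functor.map_sub] at h ⊢
    rw [← Functor.map_sub] at h
    exact (isShortExact_cosyzygy X.as).left_eq_zero (projective_free _)
      (isShortExact_cosyzygy Y.as) (embed_freeHom (f - g)) (freeHom_toCosyzygy (f - g)) h

instance : (Omega k G).Faithful where
  map_injective {X Y f g} h := by
    obtain ⟨f, rfl⟩ := (proj k G).map_surjective (X := X.as) (Y := Y.as) f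
    obtain ⟨g, rfl⟩ := (proj k G).map_surjective (X := X.as) (Y := Y.as) g
    rw [← sub_eq_zero, ← Functor.map_sub] at h ⊢
    rw [← Functor.map_sub] at h
    exact (isShortExact_syzygy X.as).right_eq_zero (projective_free _)
      (isShortExact_syzygy Y.as) (syzygy_map_fromSyzygy (f - g)) (freeHom_project (f - g)) h

instance : (Sigma k G).EssSurj where
  mem_essImage X := ⟨_, nonempty_Sigma_Omega_iso X⟩

instance : (Omega k G).EssSurj where
  mem_essImage X := ⟨_, nonempty_Omega_Sigma_iso X⟩

instance : (Sigma k G).IsEquivalence where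

instance : (Omega k G).IsEquivalence where

theorem isEquivalence_iterate {C : Type*} [Category* C] (F : C ⥤ C) [F.IsEquivalence] :
    ∀ n : ℕ, (iterate F n).IsEquivalence
  | 0 => inferInstanceAs (𝟭 C).IsEquivalence
  | n + 1 => by
    have := isEquivalence_iterate F n
    exact inferInstanceAs (iterate F n ⋙ F).IsEquivalence

instance (r : ℤ) : (SigmaPow k G r).IsEquivalence := by
  cases r with
  | ofNat n => exact isEquivalence_iterate _ n
  | negSucc n => exact isEquivalence_iterate _ (n + 1)

end Shift

/-! ### Completing morphisms to distinguished triangles -/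

section Triangles

/-- The hypotheses say that `0 ⟶ X ⟶ I ⊕ Y ⟶ Z ⟶ 0`, with first map `(a, -u)`, is exact, which is
the pushout property. -/
theorem isPushout_of_exact {X I Y Z : FGMod k G} {a : X ⟶ I} {u : X ⟶ Y} {i : I ⟶ Z} {v : Y ⟶ Z}
    (ha : Function.Injective a.hom.hom) (w : a ≫ i = u ≫ v)
    (hs : ∀ z : Z, ∃ (p : I) (y : Y), i.hom.hom p + v.hom.hom y = z)
    (hk : ∀ (p : I) (y : Y), i.hom.hom p + v.hom.hom y = 0 →
      ∃ x : X, a.hom.hom x = p ∧ -u.hom.hom x = y) : IsPushout a u i v := by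
  have w' : ∀ x, i.hom.hom (a.hom.hom x) = v.hom.hom (u.hom.hom x) := fun x =>
    congrArg (fun f : X ⟶ Z => f.hom.hom x) w
  let B := prodBicone k G I Y
  let j : X ⟶ B.pt := ConcreteCategory.ofHom (C := FGMod k G) (a.hom.hom.prod (-u.hom.hom))
  let s : B.pt ⟶ Z := ConcreteCategory.ofHom (C := FGMod k G) (i.hom.hom.coprod v.hom.hom)
  have hex : IsShortExact j s := by
    refine ⟨fun x y h => ha (congrArg Prod.fst h), fun z => ?_, le_antisymm ?_ ?_⟩
    · obtain ⟨p, y, h⟩ := hs z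
      exact ⟨(p, y), h⟩
    · rintro _ ⟨x, rfl⟩
      change i.hom.hom (a.hom.hom x) + v.hom.hom (-u.hom.hom x) = 0
      rw [map_neg, w', add_neg_cancel]
    · rintro ⟨p, y⟩ h
      obtain ⟨x, rfl, rfl⟩ := hk p y h
      exact ⟨x, rfl⟩
  have hl : B.inl ≫ s = i := by
    refine FGModuleCat.hom_ext (LinearMap.ext fun p => ?_)
    change i.hom.hom p + v.hom.hom 0 = _
    rw [map_zero, add_zero]
  have hr : B.inr ≫ s = v := by
    refine FGModuleCat.hom_ext (LinearMap.ext fun y => ?_)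
    change i.hom.hom 0 + v.hom.hom y = _
    rw [map_zero, zero_add]
  have desc : ∀ c : PushoutCocone a u, ∃ d : Z ⟶ c.pt, i ≫ d = c.inl ∧ v ≫ d = c.inr := by
    intro c
    have hc : ∀ x, c.inl.hom.hom (a.hom.hom x) = c.inr.hom.hom (u.hom.hom x) := fun x =>
      congrArg (fun f : X ⟶ c.pt => f.hom.hom x) c.condition
    obtain ⟨d, hd⟩ := hex.exists_desc (B.fst ≫ c.inl + B.snd ≫ c.inr) (by
      refine FGModuleCat.hom_ext (LinearMap.ext fun x => ?_)
      change c.inl.hom.hom (a.hom.hom x) + c.inr.hom.hom (-u.hom.hom x) = 0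
      rw [map_neg, hc, add_neg_cancel])
    refine ⟨d, ?_, ?_⟩
    · rw [← hl, Category.assoc, hd, Preadditive.comp_add, B.inl_fst_assoc, B.inl_snd_assoc,
        zero_comp, add_zero]
    · rw [← hr, Category.assoc, hd, Preadditive.comp_add, B.inr_fst_assoc, B.inr_snd_assoc,
        zero_comp, zero_add]
  choose d hd₁ hd₂ using desc
  refine ⟨⟨w⟩, ⟨PushoutCocone.IsColimit.mk w d hd₁ hd₂ fun c m h₁ h₂ => ?_⟩⟩
  refine FGModuleCat.hom_ext (LinearMap.ext fun z => ?_)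
  obtain ⟨p, y, rfl⟩ := hs z
  rw [map_add, map_add]
  congr 1
  · exact congrArg (fun f : I ⟶ c.pt => f.hom.hom p) (h₁.trans (hd₁ c).symm)
  · exact congrArg (fun f : Y ⟶ c.pt => f.hom.hom y) (h₂.trans (hd₂ c).symm)

theorem prodBicone_total (X Y : FGMod k G) :
    (prodBicone k G X Y).fst ≫ (prodBicone k G X Y).inl +
      (prodBicone k G X Y).snd ≫ (prodBicone k G X Y).inr = 𝟙 (prodBicone k G X Y).pt := by
  refine FGModuleCat.hom_ext (LinearMap.ext fun x => ?_)
  change ((x : X × Y).1, (0 : Y)) + ((0 : X), (x : X × Y).2) = (x : X × Y)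
  rw [Prod.mk_add_mk, add_zero, zero_add]
  rfl

theorem IsDistinguished.comp_eq_zero {X Y Z : Stmod k G} {u : X ⟶ Y} {v : Y ⟶ Z}
    {w : Z ⟶ (Sigma k G).obj X} (h : IsDistinguished u v w) : v ≫ w = 0 := by
  obtain ⟨X', Y', Z', u', v', w', a, b, c, ⟨i, -, -, hvw⟩, -, h₂, h₃⟩ := h
  have : v ≫ c.hom ≫ (proj k G).map w' = 0 := by
    rw [← Category.assoc, h₂, Category.assoc, ← Functor.map_comp, hvw, Functor.map_zero, comp_zero]
  rw [← cancel_mono ((Sigma k G).map a.hom), Category.assoc, h₃, zero_comp]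
  exact this

/-- Every morphism `Z ⟶ Σ X` is the third morphism of a distinguished triangle. Its second
morphism is a weak kernel of `w`, and `w` is a weak cokernel of its second morphism. -/
theorem exists_isDistinguished {X Z : Stmod k G} (w : Z ⟶ (Sigma k G).obj X) :
    ∃ (Y : Stmod k G) (u : X ⟶ Y) (v : Y ⟶ Z), IsDistinguished u v w ∧
      (∀ (W : Stmod k G) (f : W ⟶ Z), f ≫ w = 0 → ∃ f' : W ⟶ Y, f' ≫ v = f) ∧
      (∀ (T : Stmod k G) (g : Z ⟶ T), v ≫ g = 0 → ∃ h : (Sigma k G).obj X ⟶ T, w ≫ h = g) := by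
  obtain ⟨X⟩ := X
  obtain ⟨Z⟩ := Z
  obtain ⟨w, rfl⟩ := (proj k G).map_surjective (X := Z) (Y := (cosyzygy k G).obj X) w
  let B := prodBicone k G Z (free k G X)
  -- Adding a free summand to `Z` does not change it stably but makes the map to `Σ X` surjective,
  -- so that its module-theoretic kernel can serve as `Y`.
  let w' : B.pt ⟶ (cosyzygy k G).obj X := B.fst ≫ w + B.snd ≫ toCosyzygy X
  have hX := isShortExact_cosyzygy X
  have inl_w' : B.inl ≫ w' = w := by
    rw [Preadditive.comp_add, B.inl_fst_assoc, B.inl_snd_assoc, zero_comp, add_zero]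
  have inr_w' : B.inr ≫ w' = toCosyzygy X := by
    rw [Preadditive.comp_add, B.inr_fst_assoc, B.inr_snd_assoc, zero_comp, zero_add]
  have inr_w'_apply : ∀ p, w'.hom.hom (B.inr.hom.hom p) = (toCosyzygy X).hom.hom p := fun p =>
    congrArg (fun f : free k G X ⟶ (cosyzygy k G).obj X => f.hom.hom p) inr_w'
  let Y : FGMod k G := FGModuleCat.of _ (LinearMap.ker w'.hom.hom)
  let v' : Y ⟶ B.pt := ConcreteCategory.ofHom (C := FGMod k G) (LinearMap.ker w'.hom.hom).subtype
  have hY : IsShortExact v' w' := by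
    refine ⟨Subtype.val_injective, fun z => ?_, Submodule.range_subtype _⟩
    obtain ⟨p, rfl⟩ := hX.surjective z
    exact ⟨B.inr.hom.hom p, inr_w'_apply p⟩
  obtain ⟨u', hu'⟩ := hY.exists_factor (embed X ≫ B.inr) (by
    rw [Category.assoc, inr_w', hX.comp_eq_zero])
  have hfi : (proj k G).map (B.fst ≫ B.inl) = 𝟙 _ := by
    rw [← CategoryTheory.Functor.map_id, ← prodBicone_total, Functor.map_add,
      proj_map_eq_zero_of_factors (projective_free X) (prodBicone k G Z (free k G X)).snd, add_zero]
  let c : (proj k G).obj Z ≅ (proj k G).obj B.pt :=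
    ⟨(proj k G).map B.inl, (proj k G).map B.fst, by
      rw [← Functor.map_comp, B.inl_fst, CategoryTheory.Functor.map_id], by
      rw [← Functor.map_comp, hfi]⟩
  refine ⟨(proj k G).obj Y, (proj k G).map u', (proj k G).map (v' ≫ B.fst), ?_, ?_, ?_⟩
  · refine ⟨X, Y, B.pt, u', v', w', Iso.refl _, Iso.refl _, c, ⟨B.inr, ?_, inr_w',
      hY.comp_eq_zero⟩, ?_, ?_, ?_⟩
    · refine isPushout_of_exact hX.injective hu'.symm (fun z => ?_) (fun p y h => ?_)
      · obtain ⟨p, hp⟩ := hX.surjective (w'.hom.hom z)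
        have hmem : z - B.inr.hom.hom p ∈ LinearMap.ker w'.hom.hom := by
          rw [LinearMap.mem_ker, map_sub, sub_eq_zero, inr_w'_apply, hp]
        exact ⟨p, ⟨_, hmem⟩, add_sub_cancel _ _⟩
      · have hp : (toCosyzygy X).hom.hom p = 0 := by
          have hy : w'.hom.hom (v'.hom.hom y) = 0 := y.2
          have hw := congrArg w'.hom.hom h
          rwa [map_add, hy, add_zero, inr_w'_apply, map_zero] at hw
        rw [← LinearMap.mem_ker, ← hX.range_eq_ker] at hp
        obtain ⟨x, rfl⟩ := hp
        refine ⟨x, rfl, hY.injective ?_⟩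
        rw [map_neg, neg_eq_iff_add_eq_zero, ← h]
        exact congrArg (· + v'.hom.hom y)
          (congrArg (fun f : X ⟶ B.pt => f.hom.hom x) hu')
    · exact (Category.comp_id _).trans (Category.id_comp _).symm
    · rw [Functor.map_comp, Category.assoc]
      refine (congrArg (_ ≫ ·) c.inv_hom_id).trans ?_
      exact (Category.comp_id _).trans (Category.id_comp _).symm
    · refine (congrArg (_ ≫ ·) ((Sigma k G).map_id _)).trans ((Category.comp_id _).trans ?_)
      rw [← inl_w', Functor.map_comp]
  · rintro ⟨W⟩ f hf
    obtain ⟨f, rfl⟩ := (proj k G).map_surjective (X := W) (Y := Z) f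
    replace hf : (proj k G).map (f ≫ w) = 0 := ((proj k G).map_comp f w).trans hf
    obtain ⟨P, hP, a, b, hab⟩ := (proj_map_eq_zero_iff _).1 hf
    -- The projective obstruction to `f ≫ w = 0` is lifted into the free summand; after this
    -- correction `f` lands in the kernel of `w'`.
    obtain ⟨l, hl⟩ := exists_lift hP (toCosyzygy X) hX.surjective b
    obtain ⟨d, hd⟩ := hY.exists_factor (f ≫ B.inl - a ≫ l ≫ B.inr) (by
      rw [Preadditive.sub_comp, Category.assoc, inl_w', Category.assoc, Category.assoc, inr_w', hl,
        hab, sub_self])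
    refine ⟨(proj k G).map d, ?_⟩
    rw [← Functor.map_comp, ← Category.assoc, hd, Preadditive.sub_comp, Category.assoc, B.inl_fst,
      Category.assoc, Category.assoc, B.inr_fst, comp_zero, comp_zero, sub_zero, Category.comp_id]
  · rintro ⟨T⟩ g hg
    obtain ⟨g, rfl⟩ := (proj k G).map_surjective (X := Z) (Y := T) g
    rw [← Functor.map_comp] at hg
    obtain ⟨P, hP, a, b, hab⟩ := (proj_map_eq_zero_iff _).1 hg
    -- Dually, the obstruction is extended to the middle term; the corrected map vanishes on `Y` and
    -- descends along `w'`.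
    obtain ⟨l, hl⟩ := exists_extend hP v' hY.injective a
    obtain ⟨h, hh⟩ := hY.exists_desc (B.fst ≫ g - l ≫ b) (by
      rw [Preadditive.comp_sub, ← Category.assoc, hab, ← hl, Category.assoc, sub_self])
    refine ⟨(proj k G).map h, ((proj k G).map_comp w h).symm.trans ?_⟩
    rw [← inl_w', Category.assoc, hh, Preadditive.comp_sub, B.inl_fst_assoc,
      Functor.map_sub, ← Category.assoc, proj_map_eq_zero_of_factors hP, sub_zero]

end Triangles

/-! ### Indecomposable objects and induction over direct sums -/

section Decomposition

variable {C : Type*} [Category* C] [Preadditive C] [HasBinaryBiproducts C]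

theorem indecomposable_of_iso {X Y : C} (e : X ≅ Y) (h : Indecomposable X) : Indecomposable Y :=
  ⟨fun hY => h.1 (hY.of_iso e), fun A B f => h.2 A B (e ≪≫ f)⟩

theorem indecomposable_map {D : Type*} [Category* D] [Preadditive D] [HasBinaryBiproducts D]
    (F : C ⥤ D) [F.IsEquivalence] {X : C} (h : Indecomposable X) : Indecomposable (F.obj X) := by
  have hz : ∀ Y : D, IsZero (F.inv.obj Y) → IsZero Y := fun Y hY =>
    (F.map_isZero hY).of_iso (F.asEquivalence.counitIso.app Y).symm
  have := preservesBinaryBiproducts_of_preservesBinaryCoproducts F.inv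
  refine ⟨fun hX => h.1 ((F.inv.map_isZero hX).of_iso (F.asEquivalence.unitIso.app X)),
    fun A B e => ?_⟩
  exact (h.2 _ _ (F.asEquivalence.unitIso.app X ≪≫ F.inv.mapIso e ≪≫ F.inv.mapBiprod A B)).imp
    (hz A) (hz B)

/-- In a category with finite-dimensional endomorphism algebras, a property of objects that holds
for indecomposable objects and is stable under direct sums holds for all objects. -/
theorem indecomposable_induction (k : Type*) [Field k] [Linear k C]
    (hfin : ∀ X : C, Module.Finite k (X ⟶ X)) (P : C → Prop) (zero : ∀ X, IsZero X → P X)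
    (indecomposable : ∀ X, Indecomposable X → P X) (sum : ∀ A B, P A → P B → P (A ⊞ B))
    (iso : ∀ A B, (A ≅ B) → P A → P B) (X : C) : P X := by
  induction hn : Module.finrank k (X ⟶ X) using Nat.strong_induction_on generalizing X with
  | _ n ih =>
    by_cases hX : Indecomposable X
    · exact indecomposable X hX
    by_cases hX0 : IsZero X
    · exact zero X hX0
    obtain ⟨A, B, e, hA, hB⟩ : ∃ (A B : C) (_ : X ≅ A ⊞ B), ¬ IsZero A ∧ ¬ IsZero B := by
      by_contra! H
      exact hX ⟨hX0, fun A B e => or_iff_not_imp_left.2 (H A B e)⟩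
    -- Diagonal endomorphisms embed in `End X`, and both factors have positive dimension, so each
    -- summand has a strictly smaller endomorphism algebra.
    let Φ : ((A ⟶ A) × (B ⟶ B)) →ₗ[k] (X ⟶ X) :=
      { toFun := fun f => e.hom ≫ biprod.map f.1 f.2 ≫ e.inv
        map_add' := fun f g => by
          rw [← Preadditive.comp_add, ← Preadditive.add_comp]
          congr 2
          ext <;> simp
        map_smul' := fun c f => by
          rw [RingHom.id_apply, ← Linear.comp_smul, ← Linear.smul_comp]
          congr 2
          ext <;> simp }
    have hΦ : Function.Injective Φ := by
      intro f g h
      have h' : biprod.map f.1 f.2 = biprod.map g.1 g.2 := by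
        have : e.hom ≫ biprod.map f.1 f.2 ≫ e.inv = e.hom ≫ biprod.map g.1 g.2 ≫ e.inv := h
        rwa [cancel_epi, cancel_mono] at this
      refine Prod.ext ?_ ?_
      · simpa using congrArg (fun x => biprod.inl ≫ x ≫ biprod.fst) h'
      · simpa using congrArg (fun x => biprod.inr ≫ x ≫ biprod.snd) h'
    have hle := LinearMap.finrank_le_finrank_of_injective hΦ
    rw [Module.finrank_prod] at hle
    have hpos : ∀ Y : C, ¬ IsZero Y → 0 < Module.finrank k (Y ⟶ Y) := fun Y hY => by
      have : Nontrivial (Y ⟶ Y) := ⟨𝟙 Y, 0, fun h => hY ((IsZero.iff_id_eq_zero Y).2 h)⟩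
      exact Module.finrank_pos
    have hA' := hpos A hA
    have hB' := hpos B hB
    exact iso _ _ e.symm (sum A B (ih _ (by omega) A rfl) (ih _ (by omega) B rfl))

theorem isIso_of_isIso_comp {X Y : C} {f : X ⟶ Y} {g : Y ⟶ X} (h : IsIso (f ≫ g))
    (h' : IsIso (g ≫ f)) : IsIso f := by
  have : IsSplitEpi f := ⟨⟨inv (g ≫ f) ≫ g, by simp⟩⟩
  have : IsSplitMono f := ⟨⟨g ≫ inv (f ≫ g), by rw [← Category.assoc, IsIso.hom_inv_id]⟩⟩
  exact isIso_of_mono_of_isSplitEpi f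

end Decomposition

/-! ### Finite dimensionality and representatives of least dimension -/

section Finiteness

theorem finite_obj (X : FGMod k G) : Module.Finite k X.obj := Module.Finite.trans (MonoidAlgebra k G) X.obj

instance (X : FGMod k G) : Module.Finite k X.obj := finite_obj X

instance (X Y : FGMod k G) : Module.Finite k (X ⟶ Y) := by
  let Φ : (X ⟶ Y) →ₗ[k] (X.obj →ₗ[k] Y.obj) :=
    { toFun := fun f => f.hom.hom.restrictScalars k
      map_add' := fun f g => rfl
      map_smul' := fun c f => rfl }
  exact Module.Finite.of_injective Φ fun f g h => FGModuleCat.hom_ext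
    (LinearMap.ext fun x => LinearMap.congr_fun h x)

instance : (proj k G).Linear k := Quotient.linear_functor ..

instance (X Y : Stmod k G) : Module.Finite k (X ⟶ Y) :=
  Module.Finite.of_surjective ((proj k G).mapLinearMap k (X := X.as) (Y := Y.as))
    (proj k G).map_surjective

theorem isIso_of_bijective {M N : FGMod k G} (f : M ⟶ N) (h : Function.Bijective f.hom.hom) :
    IsIso f :=
  (inferInstance : IsIso (LinearEquiv.toFGModuleCatIso
    (V := M.obj) (W := N.obj) (LinearEquiv.ofBijective f.hom.hom h)).hom)

/-- Every object of the stable category is represented by a module all of whose stable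
automorphisms are bijective. -/
theorem exists_minimal_representative (X : Stmod k G) :
    ∃ M : FGMod k G, Nonempty (X ≅ (proj k G).obj M) ∧
      ∀ g : M ⟶ M, IsIso ((proj k G).map g) → Function.Bijective g.hom.hom := by
  let S : Set ℕ := {n | ∃ M : FGMod k G, Nonempty (X ≅ (proj k G).obj M) ∧
    Module.finrank k M.obj = n}
  have hS : S.Nonempty := ⟨_, X.as, ⟨Iso.refl _⟩, rfl⟩
  obtain ⟨M, ⟨e⟩, hM⟩ := Nat.sInf_mem hS
  refine ⟨M, ⟨e⟩, fun g hg => ?_⟩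
  have hpow : ∀ n : ℕ, IsIso ((proj k G).map
      (ConcreteCategory.ofHom (C := FGMod k G) (X := M) (Y := M) (g.hom.hom ^ n))) := by
    intro n
    induction n with
    | zero => exact inferInstanceAs (IsIso ((proj k G).map (𝟙 M)))
    | succ n ih =>
      have : (ConcreteCategory.ofHom (C := FGMod k G) (X := M) (Y := M) (g.hom.hom ^ (n + 1))) =
          g ≫ ConcreteCategory.ofHom (C := FGMod k G) (X := M) (Y := M) (g.hom.hom ^ n) := by
        rw [pow_succ]
        rfl
      rw [this, Functor.map_comp]
      infer_instance
  have hart : IsArtinian (MonoidAlgebra k G) M.obj := isArtinian_of_tower k inferInstance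
  -- Fitting's lemma: for large `n` the image of `g ^ n` meets its kernel trivially, so `g ^ n` is
  -- invertible on its image. That image then also represents `X`, and minimality forces it to be
  -- all of `M`. The bound `1 ≤ n` lets surjectivity pass from `g ^ n` to `g`.
  obtain ⟨n, hn, hn'⟩ := ((LinearMap.eventually_isCompl_ker_pow_range_pow g.hom.hom).and
    (Filter.eventually_ge_atTop 1)).exists
  set q : M.obj →ₗ[MonoidAlgebra k G] M.obj := g.hom.hom ^ n with hq
  let N : FGMod k G := FGModuleCat.of _ (LinearMap.range q)
  have hNfin : Module.Finite k N.obj := finite_obj N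
  let r : M ⟶ N := ConcreteCategory.ofHom (C := FGMod k G) q.rangeRestrict
  let ι : N ⟶ M := ConcreteCategory.ofHom (C := FGMod k G) (LinearMap.range q).subtype
  have h₁ : IsIso ((proj k G).map r ≫ (proj k G).map ι) := by
    rw [← Functor.map_comp]
    exact hpow n
  have hinj : Function.Injective (ι ≫ r).hom.hom := by
    rw [injective_iff_map_eq_zero]
    intro x hx
    have : x.1 ∈ LinearMap.ker q := congrArg Subtype.val hx
    exact Subtype.ext (Submodule.disjoint_def.1 hn.disjoint _ this x.2)
  have h₂ : IsIso (ι ≫ r) := isIso_of_bijective _ ⟨hinj,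
    (LinearMap.injective_iff_surjective (f := (ι ≫ r).hom.hom.restrictScalars k)).1 hinj⟩
  have h₃ : IsIso ((proj k G).map r) := isIso_of_isIso_comp h₁ (by
    rw [← Functor.map_comp]
    infer_instance)
  have hle : Module.finrank k M.obj ≤ Module.finrank k N.obj := by
    rw [hM]
    exact Nat.sInf_le ⟨N, ⟨e ≪≫ asIso ((proj k G).map r)⟩, rfl⟩
  have hsurj : Function.Surjective q := by
    have := LinearMap.injective_iff_surjective_of_finrank_eq_finrank
      (f := ι.hom.hom.restrictScalars k) (le_antisymm
        (LinearMap.finrank_le_finrank_of_injective (f := ι.hom.hom.restrictScalars k)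
          Subtype.val_injective) hle)
    intro m
    obtain ⟨x, hx⟩ := this.1 Subtype.val_injective m
    obtain ⟨y, hy⟩ := x.2
    exact ⟨y, hy.trans hx⟩
  have hg : Function.Surjective g.hom.hom := by
    obtain ⟨m, rfl⟩ : ∃ m, n = m + 1 := ⟨n - 1, by omega⟩
    intro x
    obtain ⟨y, hy⟩ := hsurj x
    rw [hq, pow_succ'] at hy
    exact ⟨_, hy⟩
  exact ⟨(LinearMap.injective_iff_surjective (f := g.hom.hom.restrictScalars k)).2 hg, hg⟩

end Finiteness

/-! ### Tate duality in the stable category -/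

section Duality

/-- Non-degeneracy of Tate duality in the stable category. -/
theorem exists_comp_ne_zero {M N : Stmod k G} (γ : M ⟶ N) (hγ : γ ≠ 0) :
    ∃ δ : N ⟶ (Omega k G).obj M, γ ≫ δ ≠ 0 := by
  obtain ⟨M⟩ := M
  obtain ⟨N⟩ := N
  obtain ⟨γ, rfl⟩ := (proj k G).map_surjective (X := M) (Y := N) γ
  obtain ⟨δ, hδ⟩ := exists_comp_not_factors k G γ.hom.hom fun u hu => hγ (by
    have : γ = ConcreteCategory.ofHom (C := FGMod k G) (X := M) (Y := free k G N) (coind k G u) ≫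
        project N := by
      refine FGModuleCat.hom_ext (LinearMap.ext fun m => ?_)
      exact (hu m).symm.trans (act_coind k G u m).symm
    rw [this]
    exact proj_map_eq_zero_of_factors (projective_free N) _ _)
  let δ' : N ⟶ (syzygy k G).obj M := ConcreteCategory.ofHom (C := FGMod k G) δ
  refine ⟨(proj k G).map δ', fun h => ?_⟩
  replace h : (proj k G).map (γ ≫ δ') = 0 := ((proj k G).map_comp γ δ').trans h
  obtain ⟨P, hP, a, b, hab⟩ := (proj_map_eq_zero_iff _).1 h
  exact hδ P.obj a.hom.hom b.hom.hom
    (congrArg (fun f : M ⟶ (syzygy k G).obj M => f.hom.hom) hab)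

end Duality

/-! ### Transformations vanishing off one indecomposable object -/

section SingleSupport

variable {F : Stmod k G ⥤ Stmod k G} {φ : 𝟭 (Stmod k G) ⟶ F} {M : Stmod k G}

theorem comp_app_eq_zero_of_app_eq_zero {X Y : Stmod k G} (f : X ⟶ Y) (h : φ.app X = 0) :
    f ≫ φ.app Y = 0 := by
  have := φ.naturality f
  rw [h, zero_comp] at this
  exact this

theorem app_eq_zero_of_comp {X Y Z : Stmod k G} (f : X ⟶ Y) (g : Y ⟶ Z) (h : φ.app Y = 0) :
    (f ≫ g) ≫ φ.app Z = 0 := by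
  rw [Category.assoc, comp_app_eq_zero_of_app_eq_zero g h, comp_zero]

theorem app_eq_zero_of_iso {X Y : Stmod k G} (e : X ≅ Y) (h : φ.app X = 0) : φ.app Y = 0 := by
  rw [← cancel_epi e.hom, comp_app_eq_zero_of_app_eq_zero e.hom h, comp_zero]

/-- If `φ` is nonzero on a direct sum, naturality along the inclusions makes it nonzero on a
summand, and a retraction onto `M` passes up from there. This replaces any appeal to uniqueness of
decompositions. -/
theorem exists_retract_of_app_ne_zero
    (hφ : ∀ V : Stmod k G, Indecomposable V → ¬ Nonempty (V ≅ M) → φ.app V = 0)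
    (X : Stmod k G) (hX : φ.app X ≠ 0) : ∃ (i : M ⟶ X) (p : X ⟶ M), i ≫ p = 𝟙 M := by
  revert hX
  refine indecomposable_induction k (fun X => inferInstance)
    (fun X => φ.app X ≠ 0 → ∃ (i : M ⟶ X) (p : X ⟶ M), i ≫ p = 𝟙 M) ?_ ?_ ?_ ?_ X
  · exact fun X h h' => (h' (h.eq_of_src _ _)).elim
  · intro X h h'
    obtain ⟨e⟩ : Nonempty (X ≅ M) := by
      by_contra H
      exact h' (hφ X h H)
    exact ⟨e.inv, e.hom, e.inv_hom_id⟩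
  · intro A B hA hB h
    by_cases hA0 : φ.app A = 0
    · by_cases hB0 : φ.app B = 0
      · refine (h (biprod.hom_ext' _ _ ?_ ?_)).elim
        · rw [comp_app_eq_zero_of_app_eq_zero biprod.inl hA0, comp_zero]
        · rw [comp_app_eq_zero_of_app_eq_zero biprod.inr hB0, comp_zero]
      · obtain ⟨i, p, hip⟩ := hB hB0
        exact ⟨i ≫ biprod.inr, biprod.snd ≫ p, by simp [hip]⟩
    · obtain ⟨i, p, hip⟩ := hA hA0
      exact ⟨i ≫ biprod.inl, biprod.fst ≫ p, by simp [hip]⟩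
  · intro A B e hA h
    obtain ⟨i, p, hip⟩ := hA fun h' => h (app_eq_zero_of_iso e h')
    exact ⟨i ≫ e.hom, e.inv ≫ p, by simp [hip]⟩

/-- The endomorphism is factored through its image on a minimal representative; if `φ` were nonzero
on the image, that image would be the whole module. -/
theorem comp_app_eq_zero_of_not_isIso
    (hφ : ∀ V : Stmod k G, Indecomposable V → ¬ Nonempty (V ≅ M) → φ.app V = 0)
    (f : M ⟶ M) (hf : ¬ IsIso f) : f ≫ φ.app M = 0 := by
  obtain ⟨M', ⟨e⟩, hM'⟩ := exists_minimal_representative M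
  obtain ⟨g, hg⟩ := (proj k G).map_surjective (e.inv ≫ f ≫ e.hom)
  have hfg : f = (e.hom ≫ (proj k G).map g) ≫ e.inv := by simp [hg]
  let N : FGMod k G := FGModuleCat.of _ (LinearMap.range g.hom.hom)
  have hNfin : Module.Finite k N.obj := finite_obj N
  let r : M' ⟶ N := ConcreteCategory.ofHom (C := FGMod k G) g.hom.hom.rangeRestrict
  let ι : N ⟶ M' := ConcreteCategory.ofHom (C := FGMod k G) (LinearMap.range g.hom.hom).subtype
  have hN : φ.app ((proj k G).obj N) = 0 := by
    by_contra h
    obtain ⟨i, p, hip⟩ := exists_retract_of_app_ne_zero hφ _ h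
    obtain ⟨i₀, hi₀⟩ := (proj k G).map_surjective (e.inv ≫ i)
    obtain ⟨p₀, hp₀⟩ := (proj k G).map_surjective (p ≫ e.hom)
    -- A stable retraction of the image onto `M` becomes, by minimality, an honest embedding of `M'`
    -- into the image of `g`. Comparing dimensions, `g` is surjective, hence invertible.
    have hb : Function.Bijective (i₀ ≫ p₀).hom.hom := hM' _ (by
      have : (proj k G).map (i₀ ≫ p₀) = 𝟙 _ := by
        rw [Functor.map_comp, hi₀, hp₀, Category.assoc, reassoc_of% hip, e.inv_hom_id]
      rw [this]
      infer_instance)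
    have hi : Function.Injective i₀.hom.hom := Function.Injective.of_comp (f := p₀.hom.hom) hb.1
    have h₁ := LinearMap.finrank_le_finrank_of_injective (f := i₀.hom.hom.restrictScalars k) hi
    have h₂ := LinearMap.injective_iff_surjective_of_finrank_eq_finrank
      (f := ι.hom.hom.restrictScalars k) (le_antisymm
        (LinearMap.finrank_le_finrank_of_injective (f := ι.hom.hom.restrictScalars k)
          Subtype.val_injective) h₁)
    have hs : Function.Surjective g.hom.hom := by
      intro m
      obtain ⟨x, hx⟩ := h₂.1 Subtype.val_injective m
      obtain ⟨y, hy⟩ := x.2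
      exact ⟨y, hy.trans hx⟩
    have : IsIso g := isIso_of_bijective g
      ⟨(LinearMap.injective_iff_surjective (f := g.hom.hom.restrictScalars k)).2 hs, hs⟩
    exact hf (by rw [hfg]; infer_instance)
  have hgr : g = r ≫ ι := rfl
  have : f = (e.hom ≫ (proj k G).map r) ≫ (proj k G).map ι ≫ e.inv := by
    rw [hfg, hgr, Functor.map_comp]
    simp only [Category.assoc]
  rw [this]
  exact app_eq_zero_of_comp _ _ hN

theorem comp_app_eq_zero_of_not_isSplitEpi
    (hφ : ∀ V : Stmod k G, Indecomposable V → ¬ Nonempty (V ≅ M) → φ.app V = 0)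
    {W : Stmod k G} (f : W ⟶ M) (hf : ¬ IsSplitEpi f) : f ≫ φ.app M = 0 := by
  have key : ∀ {X Y : Stmod k G} (i : X ⟶ Y) (f : Y ⟶ M), ¬ IsSplitEpi f →
      ¬ IsSplitEpi (i ≫ f) := fun i f hf h => hf ⟨⟨section_ (i ≫ f) ≫ i, by
    rw [Category.assoc, IsSplitEpi.id]⟩⟩
  revert f
  refine indecomposable_induction k (fun X => inferInstance)
    (fun X => ∀ f : X ⟶ M, ¬ IsSplitEpi f → f ≫ φ.app M = 0) ?_ ?_ ?_ ?_ W
  · exact fun X h f _ => h.eq_of_src _ _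
  · intro X h f hf
    by_cases he : Nonempty (X ≅ M)
    · obtain ⟨e⟩ := he
      have := comp_app_eq_zero_of_not_isIso hφ (e.inv ≫ f) fun _ => key e.inv f hf inferInstance
      rwa [Category.assoc, ← comp_zero (f := e.inv), cancel_epi] at this
    · exact comp_app_eq_zero_of_app_eq_zero f (hφ X h he)
  · intro A B hA hB f hf
    refine biprod.hom_ext' _ _ ?_ ?_
    · rw [← Category.assoc, comp_zero]
      exact hA _ (key _ _ hf)
    · rw [← Category.assoc, comp_zero]
      exact hB _ (key _ _ hf)
  · intro A B e hA f hf
    rw [← cancel_epi e.hom, ← Category.assoc, comp_zero]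
    exact hA _ (key _ _ hf)

end SingleSupport

/-! ### Cancelling iterates of functors on objects -/

section Iterate

variable {C : Type*} [Category* C]

theorem iterate_obj_obj (F : C ⥤ C) (n : ℕ) (X : C) :
    (iterate F n).obj (F.obj X) = F.obj ((iterate F n).obj X) := by
  induction n with
  | zero => rfl
  | succ n ih => exact congrArg F.obj ih

theorem nonempty_iterate_iterate_iso {F H : C ⥤ C}
    (h : ∀ X, Nonempty (H.obj (F.obj X) ≅ X)) (n : ℕ) (X : C) :
    Nonempty ((iterate H n).obj ((iterate F n).obj X) ≅ X) := by
  induction n with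
  | zero => exact ⟨Iso.refl X⟩
  | succ n ih =>
    obtain ⟨e⟩ := ih
    obtain ⟨f⟩ := h ((iterate F n).obj X)
    exact ⟨eqToIso (iterate_obj_obj H n _).symm ≪≫ (iterate H n).mapIso f ≪≫ e⟩

end Iterate

/-! ### Characterising almost vanishing morphisms -/

theorem IsAlmostVanishing.ne_zero {Z T : Stmod k G} {γ : Z ⟶ T} (h : IsAlmostVanishing γ) :
    γ ≠ 0 := by
  obtain ⟨X, Y, u, v, w, e, h, rfl⟩ := h
  exact fun h' => h.ne_zero (by rwa [← zero_comp (f := e.hom), cancel_mono] at h')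

theorem IsAlmostVanishing.comp_eq_zero {Z T : Stmod k G} {γ : Z ⟶ T} (h : IsAlmostVanishing γ)
    {W : Stmod k G} (f : W ⟶ Z) (hf : ¬ IsSplitEpi f) : f ≫ γ = 0 := by
  obtain ⟨X, Y, u, v, w, e, h, rfl⟩ := h
  obtain ⟨f', rfl⟩ := h.lift f hf
  rw [Category.assoc, reassoc_of% h.distinguished.comp_eq_zero, zero_comp, comp_zero]

theorem IsAlmostVanishing.comp_iso {Z T T' : Stmod k G} {γ : Z ⟶ T} (h : IsAlmostVanishing γ)
    (e : T ≅ T') : IsAlmostVanishing (γ ≫ e.hom) := by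
  obtain ⟨X, Y, u, v, w, e', h, rfl⟩ := h
  exact ⟨X, Y, u, v, w, e' ≪≫ e, h, by simp⟩

/-- Identifying `T` with `Σ Ω T`, complete `γ` to a triangle starting at `Ω T`; since its second map
is a weak kernel, vanishing of `f ≫ γ` is what the lifting property requires. -/
theorem isAlmostVanishing_of_comp_eq_zero {Z T : Stmod k G} (hZ : Indecomposable Z)
    (hT : Indecomposable T) {γ : Z ⟶ T} (hγ : γ ≠ 0)
    (h : ∀ (W : Stmod k G) (f : W ⟶ Z), ¬ IsSplitEpi f → f ≫ γ = 0) : IsAlmostVanishing γ := by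
  obtain ⟨e⟩ := nonempty_Sigma_Omega_iso T
  obtain ⟨Y, u, v, huv, hv, -⟩ := exists_isDistinguished (γ ≫ e.inv)
  refine ⟨_, Y, u, v, γ ≫ e.inv, e, ⟨huv, indecomposable_map (Omega k G) hT, hZ, fun h' => hγ ?_,
    fun {W} f hf => hv W f ?_⟩, by simp⟩
  · rwa [← zero_comp (f := e.inv), cancel_mono] at h'
  · rw [← Category.assoc, h W f hf, zero_comp]

/-- A morphism killed by all non-split epimorphisms onto its source factors through every nonzero
morphism with that source. -/
theorem exists_factor_of_comp_eq_zero {Z T T' : Stmod k G} {γ : Z ⟶ T} (hγ : γ ≠ 0) (γ' : Z ⟶ T')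
    (h : ∀ (W : Stmod k G) (f : W ⟶ Z), ¬ IsSplitEpi f → f ≫ γ' = 0) :
    ∃ a : T ⟶ T', γ ≫ a = γ' := by
  obtain ⟨e⟩ := nonempty_Sigma_Omega_iso T
  obtain ⟨Y, u, v, huv, -, hw⟩ := exists_isDistinguished (γ ≫ e.inv)
  -- The map `v` cannot be a split epimorphism, as it composes to zero with `γ ≠ 0`. Hence `γ'`
  -- kills it and factors through the weak cokernel.
  obtain ⟨a, ha⟩ := hw T' γ' (h Y v fun hv => hγ (by
    rw [← cancel_mono e.inv, zero_comp, ← Category.id_comp (γ ≫ e.inv), ← IsSplitEpi.id v,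
      Category.assoc, huv.comp_eq_zero, comp_zero]))
  exact ⟨e.inv ≫ a, by rw [← Category.assoc, ha]⟩

/-! ### Consequences of one-point support for an equivalence `F` -/

section SingleSupport

variable {F : Stmod k G ⥤ Stmod k G} {φ : 𝟭 (Stmod k G) ⟶ F} {M : Stmod k G}

theorem indecomposable_and_app_ne_zero (hφ : support φ = {isoClass M}) :
    Indecomposable M ∧ φ.app M ≠ 0 := by
  have hM : isoClass M ∈ support φ := hφ ▸ Set.mem_singleton _
  obtain ⟨N, hN, hN0, h⟩ := hM
  obtain ⟨e⟩ : Nonempty (M ≅ N) := _root_.Quotient.exact h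
  exact ⟨indecomposable_of_iso e.symm hN, fun h => hN0 (app_eq_zero_of_iso e h)⟩

theorem app_eq_zero_of_support_eq (hφ : support φ = {isoClass M}) (V : Stmod k G)
    (hV : Indecomposable V) (h : ¬ Nonempty (V ≅ M)) : φ.app V = 0 := by
  by_contra hV0
  have : isoClass V ∈ support φ := ⟨V, hV, hV0, rfl⟩
  rw [hφ] at this
  exact h (_root_.Quotient.exact this)

variable [F.IsEquivalence]

theorem isAlmostVanishing_app (hφ : support φ = {isoClass M}) : IsAlmostVanishing (φ.app M) :=
  have h := indecomposable_and_app_ne_zero hφ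
  isAlmostVanishing_of_comp_eq_zero h.1 (indecomposable_map F h.1) h.2 fun _ f hf =>
    comp_app_eq_zero_of_not_isSplitEpi (app_eq_zero_of_support_eq hφ) f hf

/-- A dual partner `δ : F M ⟶ Ω M` of `φ_M` comes from a map `g : M ⟶ N` with `F N ≅ Ω M`. By
naturality `φ_N` cannot vanish, so `N` must be `M`. -/
theorem nonempty_iso_Omega (hφ : support φ = {isoClass M}) :
    Nonempty (F.obj M ≅ (Omega k G).obj M) := by
  have h := indecomposable_and_app_ne_zero hφ
  obtain ⟨δ, hδ⟩ := exists_comp_ne_zero (φ.app M) h.2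
  let N := F.objPreimage ((Omega k G).obj M)
  let e : F.obj N ≅ (Omega k G).obj M := F.objObjPreimageIso _
  obtain ⟨g, hg⟩ := F.map_surjective (δ ≫ e.inv)
  have hN : Indecomposable N := indecomposable_of_iso (F.asEquivalence.unitIso.app N).symm
    (indecomposable_map F.inv (indecomposable_of_iso e.symm
      (indecomposable_map (Omega k G) h.1)))
  by_contra H
  have h0 : φ.app N = 0 := app_eq_zero_of_support_eq hφ N hN
    fun ⟨f⟩ => H ⟨F.mapIso f.symm ≪≫ e⟩
  have h1 : φ.app M ≫ F.map g = 0 := by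
    rw [← φ.naturality, h0, comp_zero]
  rw [hg, ← Category.assoc] at h1
  exact hδ (by rwa [← zero_comp (f := e.inv), cancel_mono] at h1)

theorem exists_smul_app_eq [IsAlgClosed k] (hφ : support φ = {isoClass M}) (γ : M ⟶ F.obj M)
    (hγ : γ ≠ 0) (h : ∀ (W : Stmod k G) (f : W ⟶ M), ¬ IsSplitEpi f → f ≫ γ = 0) :
    ∃ c : k, c ≠ 0 ∧ c • φ.app M = γ := by
  have hM := indecomposable_and_app_ne_zero hφ
  obtain ⟨a, ha⟩ := exists_factor_of_comp_eq_zero hM.2 γ h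
  obtain ⟨a, rfl⟩ := F.map_surjective a
  have : Nontrivial (End M) := ⟨𝟙 M, 0, fun h => hM.1.1 ((IsZero.iff_id_eq_zero M).2 h)⟩
  have : FiniteDimensional k (End M) := inferInstanceAs (Module.Finite k (M ⟶ M))
  -- With an eigenvalue `c`, the map `c - a` is not invertible, so it is killed by `φ_M`; naturality
  -- turns `a ≫ φ_M` into `φ_M ≫ F a`, which is `γ`.
  obtain ⟨c, hc⟩ := spectrum.nonempty_of_isAlgClosed_of_finiteDimensional k (End.of a)
  have hiso : ¬ IsIso (c • 𝟙 M - a) := fun h => hc ((isUnit_iff_isIso _).2 h)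
  have key := comp_app_eq_zero_of_not_isIso (app_eq_zero_of_support_eq hφ) _ hiso
  have hca : c • φ.app M = γ := by
    rw [Preadditive.sub_comp, Linear.smul_comp, Category.id_comp, sub_eq_zero] at key
    exact (key.trans (φ.naturality a)).trans ha
  exact ⟨c, fun h0 => hγ (by rw [← hca, h0, zero_smul]), hca⟩

end SingleSupport

theorem nonempty_iso_OmegaPow {r : ℤ} {M : Stmod k G} (hr : r ≠ -1)
    (e : (SigmaPow k G r).obj M ≅ (Omega k G).obj M) :
    Nonempty (M ≅ (OmegaPow k G (r + 1)).obj M) ∧ IsPeriodic M := by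
  cases r with
  | ofNat n =>
    -- Applying `Ω^n` to `Σ^n M ≅ Ω M` gives `M ≅ Ω^(n+1) M`.
    obtain ⟨f⟩ := nonempty_iterate_iterate_iso (nonempty_Omega_Sigma_iso (k := k) (G := G)) n M
    have i : M ≅ (SigmaPow k G (Int.negSucc n)).obj M :=
      f.symm ≪≫ (iterate (Omega k G) n).mapIso e ≪≫ eqToIso (iterate_obj_obj _ n M)
    exact ⟨⟨i⟩, n + 1, n.succ_pos, ⟨i⟩⟩
  | negSucc n =>
    -- Here `r = -(n + 1)`, so `r ≠ -1` means `n ≥ 1`. Cancelling one `Ω` from `Ω^(m+2) M ≅ Ω M`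
    -- leaves the positive period `m + 1`, while `Ω^(r+1)` is `Σ^(m+1)`.
    obtain ⟨m, rfl⟩ : ∃ m, n = m + 1 := ⟨n - 1, by omega⟩
    have i : (SigmaPow k G (Int.negSucc m)).obj M ≅ M := (Omega k G).preimageIso e
    obtain ⟨f⟩ := nonempty_iterate_iterate_iso (nonempty_Sigma_Omega_iso (k := k) (G := G))
      (m + 1) M
    have j : M ≅ (SigmaPow k G (Int.ofNat (m + 1))).obj M :=
      f.symm ≪≫ (iterate (Sigma k G) (m + 1)).mapIso i
    exact ⟨⟨j⟩, m + 1, m.succ_pos, ⟨i.symm⟩⟩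

end

end StMod

/-! ### The main theorem -/

theorem mainTheorem12 (k G : Type u) [Field k] [Group G] [Fintype G] (r : ℤ)
    (φ : 𝟭 (StMod.Stmod k G) ⟶ StMod.SigmaPow k G r)
    (M : StMod.Stmod k G) (hφ : StMod.support φ = {StMod.isoClass M}) :
    (∃ e : (StMod.SigmaPow k G r).obj M ≅ (StMod.Omega k G).obj M,
      StMod.IsAlmostVanishing (φ.app M ≫ e.hom)) ∧
    (r ≠ -1 →
      Nonempty (M ≅ (StMod.OmegaPow k G (r + 1)).obj M) ∧
      StMod.IsPeriodic M ∧
      (∃ (ζ : M ⟶ (StMod.Omega k G).obj M)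
        (θ : (StMod.Omega k G).obj M ≅ (StMod.SigmaPow k G r).obj M)
        (ψ : 𝟭 (StMod.Stmod k G) ⟶ StMod.SigmaPow k G r) (c : k),
        StMod.IsLinckelmannStancu ζ θ ψ ∧ c ≠ 0 ∧ φ = c • ψ) ∧
      (IsAlgClosed k →
        ∀ (ζ : M ⟶ (StMod.Omega k G).obj M)
          (θ : (StMod.Omega k G).obj M ≅ (StMod.SigmaPow k G r).obj M),
          StMod.IsAlmostVanishing ζ →
          ∃ (ψ : 𝟭 (StMod.Stmod k G) ⟶ StMod.SigmaPow k G r) (c : k),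
            StMod.IsLinckelmannStancu ζ θ ψ ∧ c ≠ 0 ∧ φ = c • ψ)) := by
  obtain ⟨e⟩ := StMod.nonempty_iso_Omega hφ
  have hM := (StMod.indecomposable_and_app_ne_zero hφ).1
  have hav := (StMod.isAlmostVanishing_app hφ).comp_iso e
  refine ⟨⟨e, hav⟩, fun hr => ?_⟩
  obtain ⟨hiso, hper⟩ := StMod.nonempty_iso_OmegaPow hr e
  -- The transformation `φ` is its own Linckelmann–Stancu transformation, with scalar `1`, once `F
  -- M` is identified with `Ω M`.
  refine ⟨hiso, hper, ⟨φ.app M ≫ e.hom, e.symm, φ, 1, ⟨hM, hper, hav, ?_,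
    StMod.app_eq_zero_of_support_eq hφ⟩, one_ne_zero, (one_smul k φ).symm⟩, fun hk ζ θ hζ => ?_⟩
  · exact (Category.comp_id _).symm.trans
      ((congrArg (φ.app M ≫ ·) e.hom_inv_id.symm).trans (Category.assoc _ _ _).symm)
  · have hζθ := hζ.comp_iso θ
    obtain ⟨c, hc, h⟩ := StMod.exists_smul_app_eq hφ (ζ ≫ θ.hom) hζθ.ne_zero
      fun W f hf => hζθ.comp_eq_zero f hf
    -- Existence for prescribed `ζ` and `θ` is free: rescaling `φ` by the `c` with `c • φ_M = ζ ≫ θ`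
    -- already has the required components.
    refine ⟨c • φ, c⁻¹, ⟨hM, hper, hζ, h, fun V hV hVM => ?_⟩, inv_ne_zero hc, ?_⟩
    · exact (congrArg (c • ·) (StMod.app_eq_zero_of_support_eq hφ V hV hVM)).trans (smul_zero c)
    · rw [smul_smul, inv_mul_cancel₀ hc, one_smul]
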